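/- There exists an absolute constant $c>0$ such that the following holds. Let $n\ge 1$, let $\Sigma$ be a real symmetric positive definite $n\times n$ matrix, let $\mu=\mathcal N(0,\Sigma)$ be the centered Gaussian measure on $\mathbb R^n$ with covariance matrix $\Sigma$, and let $\sqrt\Sigma$ be a symmetric square root of $\Sigma$, i.e. any real symmetric $n\times n$ matrix with $(\sqrt\Sigma)^2=\Sigma$. Let $$\|\sqrt\Sigma\|_{\infty,op}=\sup_{x\in\mathbb R^n\setminus\{0\}}\frac{|\sqrt\Sigma\,x|_\infty}{|x|_\infty}$$ be its operator norm for the sup norm $|\cdot|_\infty$ on $\mathbb R^n$. For a Borel set $A\subseteq\mathbb R^n$ and $i\in\{1,\dots,n\}$ define the influence $$I_{i,\mu}(A)=\liminf_{r\downarrow 0}\frac{\mu\big(A+[-r,r]\,e_i\big)-\mu(A)}{r}\in[0,+\infty],$$ where $(e_1,\dots,e_n)$ is the canonical basis of $\mathbb R^n$ and $A+[-r,r]\,e_i=\{a+te_i : a\in A,\ t\in[-r,r]\}$. Then for every Borel set $A\subseteq\mathbb R^n$ that is monotonic, i.e. increasing or decreasing for the coordinatewise order on $\mathbb R^n$, $$\sum_{i=1}^n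 I_{i,\mu}(A)\ \ge\ c\,\|\sqrt\Sigma\|_{\infty,op}^{-1}\,\mu(A)\,(1-\mu(A))\,\sqrt{\log_+\!\left(\frac{1}{\|\sqrt\Sigma\|_{\infty,op}\cdot\max_{1\le i\le n} I_{i,\mu}(A)}\right)}\,.$$ Here $\log_+=\max(\log,0)$, and both sides are read in $[0,+\infty]$ with the conventions $1/0=+\infty$, $1/\infty=0$, $\log_+(0)=0$, $\log_+(+\infty)=+\infty$, $\sqrt{+\infty}=+\infty$ and $0\cdot\infty=0$. -/

import Mathlib

open MeasureTheory ProbabilityTheory Filter Topology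
open scoped ENNReal Pointwise

namespace GaussianKKL

/-- The enlargement `A + [-r, r] v` of `A` in the direction `v`. -/
def thicken {n : ℕ} (A : Set (EuclideanSpace ℝ (Fin n))) (r : ℝ) (v : EuclideanSpace ℝ (Fin n)) :
    Set (EuclideanSpace ℝ (Fin n)) :=
  A + (fun t : ℝ => t • v) '' Set.Icc (-r) r

/-- The influence of the vector `v` on `A` under `μ`:
`liminf_{r ↓ 0} (μ (A + [-r, r] v) - μ A) / r`, as an element of `[0, ∞]`. For finite `μ` and
`r > 0` the subtraction in `[0, ∞]` is the usual one, because `A ⊆ A + [-r, r] v`. -/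
noncomputable def influence {n : ℕ} (μ : Measure (EuclideanSpace ℝ (Fin n)))
    (v : EuclideanSpace ℝ (Fin n)) (A : Set (EuclideanSpace ℝ (Fin n))) : ℝ≥0∞ :=
  liminf (fun r : ℝ => (μ (thicken A r v) - μ A) / ENNReal.ofReal r) (𝓝[>] (0 : ℝ))

/-- The influence of the `i`-th vector of the canonical basis. -/
noncomputable def coordInfluence {n : ℕ} (μ : Measure (EuclideanSpace ℝ (Fin n)))
    (i : Fin n) (A : Set (EuclideanSpace ℝ (Fin n))) : ℝ≥0∞ :=
  influence μ (EuclideanSpace.single i (1 : ℝ)) A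

/-- `A` is increasing for the coordinatewise order. -/
def IsIncreasing {n : ℕ} (A : Set (EuclideanSpace ℝ (Fin n))) : Prop :=
  ∀ x ∈ A, ∀ y : EuclideanSpace ℝ (Fin n), (∀ i, x i ≤ y i) → y ∈ A

/-- `A` is decreasing for the coordinatewise order. -/
def IsDecreasing {n : ℕ} (A : Set (EuclideanSpace ℝ (Fin n))) : Prop :=
  ∀ x ∈ A, ∀ y : EuclideanSpace ℝ (Fin n), (∀ i, y i ≤ x i) → y ∈ A

/-- `A` is monotonic: increasing or decreasing. -/
def IsMonotonic {n : ℕ} (A : Set (EuclideanSpace ℝ (Fin n))) : Prop :=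
  IsIncreasing A ∨ IsDecreasing A

/-- The operator norm of the matrix `M` for the sup norm on `ℝⁿ`
(`Fin n → ℝ` carries the sup norm). -/
noncomputable def infOpNorm {n : ℕ} (M : Matrix (Fin n) (Fin n) ℝ) : ℝ :=
  ‖LinearMap.toContinuousLinearMap (Matrix.mulVecLin M : (Fin n → ℝ) →ₗ[ℝ] (Fin n → ℝ))‖

/-- `log_+ x = max (log x) 0` on `[0, ∞]`, with `log_+ 0 = 0` and `log_+ ∞ = ∞`. -/
noncomputable def logPlus (x : ℝ≥0∞) : ℝ≥0∞ :=
  (max (ENNReal.log x) 0).toENNReal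

end GaussianKKL

/-! Write `M` for the sup-norm operator norm of `R` and `γ` for the standard Gaussian measure. Since
`R` is a symmetric root of `S`, the measure is the image of `γ` under `R`, and `A` pulls back to an
indicator `f` on standard Gaussian space. Replace `f` by its Mehler average `g`, which is smooth and
tends to `f` in `L¹(γ)` as the noise vanishes.

Monotonicity gives the derivative of `g` along `v i = R⁻¹ e_i` a constant sign, so its `L¹` norm is
the derivative of the mean of a translate, hence at most the influence `I i`
(`ofReal_integral_abs_fderiv_le_coordInfluence`). Expanding `e_j = ∑ i, R i j • v i` bounds the `L¹`
norm of the `j`-th partial derivative by `J j = ∑ i, |R i j| * I i`. As rows and columns of `R` have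
`ℓ¹` norm at most `M`, each `J j` is at most `M * max I` and their sum is at most `M * ∑ I`.

It remains to prove an `L¹` Talagrand inequality: if `|g| ≤ 1` and all `J j ≤ exp (-L)`, then `Var g
≤ C * (∑ J) / √L` (`variance_le_sum_of_integral_abs_fderiv_le`). The variance is the integral over
an angle `θ` of `sin θ` times the correlations of the partial derivatives with their Mehler averages
at correlation `cos θ`. Smoothing makes a derivative of a bounded function bounded;
hypercontractivity then gains a power of the small `L¹` norm (`integral_fderiv_mul_mehler_le`). The
gain is Gaussian in `θ` at scale `1 / √L`, and integrating it yields the factor `1 / √L`.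

Hypercontractivity (`integral_mul_mehler_le`) comes from the two-point inequality, tensorised over
sums of independent correlated signs and carried to the Gaussian limit by the central limit theorem.
-/

namespace GaussianKKL

/-! ### Gaussian density, Cameron–Martin shift, differentiation of smoothed functions. -/

section Calculus

variable {E : Type*} [NormedAddCommGroup E] [InnerProductSpace ℝ E]

/-- The density of the standard Gaussian measure. -/
noncomputable def stdDensity (x : E) : ℝ :=
  (2 * Real.pi) ^ (-(Module.finrank ℝ E / 2 : ℝ)) * Real.exp (-(1 / 2) * ‖x‖ ^ 2)

lemma stdDensity_nonneg (x : E) : 0 ≤ stdDensity x := by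
  unfold stdDensity; positivity

lemma continuous_stdDensity : Continuous (stdDensity : E → ℝ) := by
  unfold stdDensity; fun_prop

variable [FiniteDimensional ℝ E] [MeasurableSpace E] [BorelSpace E]

lemma integrable_stdDensity : Integrable (stdDensity : E → ℝ) := by
  refine Integrable.const_mul ?_ _
  have h := (GaussianFourier.integrable_cexp_neg_mul_sq_norm_add (V := E) (b := (1 / 2 : ℝ))
    (by norm_num) 0 0).re
  refine h.congr (ae_of_all _ fun x => ?_)
  have : (-((1 / 2 : ℝ) : ℂ) * (‖x‖ : ℂ) ^ 2 + 0 * (inner ℝ (0 : E) x : ℝ))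
      = ((-(1 / 2) * ‖x‖ ^ 2 : ℝ) : ℂ) := by push_cast; ring
  simp only [this]
  exact Complex.exp_ofReal_re _

/-- Both sides are finite measures with the same characteristic function, so the normalisation of
the density needs no separate computation. -/
lemma stdGaussian_eq_withDensity :
    stdGaussian E = volume.withDensity (fun x => ENNReal.ofReal (stdDensity x)) := by
  have hfin : IsFiniteMeasure ((volume : Measure E).withDensity
      (fun x => ENNReal.ofReal (stdDensity x))) :=
    isFiniteMeasure_withDensity_ofReal integrable_stdDensity.2
  apply Measure.ext_of_charFun
  ext t
  rw [charFun_stdGaussian, charFun_apply, integral_withDensity_eq_integral_toReal_smul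
    (by exact (ENNReal.continuous_ofReal.comp continuous_stdDensity).measurable)
    (ae_of_all _ fun x => ENNReal.ofReal_lt_top)]
  have key : ∀ x : E, (ENNReal.ofReal (stdDensity x)).toReal •
      Complex.exp ((inner ℝ x t : ℝ) * Complex.I) =
      (((2 * Real.pi) ^ (-(Module.finrank ℝ E / 2 : ℝ)) : ℝ) : ℂ) *
        Complex.exp (-((1 / 2 : ℝ) : ℂ) * (‖x‖ : ℂ) ^ 2 + Complex.I * (inner ℝ t x : ℝ)) := by
    intro x
    rw [ENNReal.toReal_ofReal (stdDensity_nonneg x), stdDensity, Complex.real_smul,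
      Complex.exp_add, real_inner_comm, mul_comm Complex.I]
    push_cast
    ring
  simp_rw [key]
  rw [integral_const_mul, GaussianFourier.integral_cexp_neg_mul_sq_norm_add (by norm_num)]
  have h2 : ((Real.pi : ℂ) / ((1 / 2 : ℝ) : ℂ)) ^ (Module.finrank ℝ E / 2 : ℂ)
      = (((2 * Real.pi) ^ (Module.finrank ℝ E / 2 : ℝ) : ℝ) : ℂ) := by
    rw [Complex.ofReal_cpow (by positivity)]
    push_cast
    congr 1
    ring
  rw [h2, ← mul_assoc, ← Complex.ofReal_mul, ← Real.rpow_add (by positivity)]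
  simp only [neg_add_cancel, Real.rpow_zero, Complex.ofReal_one, one_mul, Complex.I_sq]
  congr 1
  push_cast
  ring

lemma integral_stdGaussian (F : E → ℝ) :
    ∫ x, F x ∂(stdGaussian E) = ∫ x, stdDensity x * F x := by
  rw [stdGaussian_eq_withDensity, integral_withDensity_eq_integral_toReal_smul
    (by exact (ENNReal.continuous_ofReal.comp continuous_stdDensity).measurable)
    (ae_of_all _ fun x => ENNReal.ofReal_lt_top)]
  simp_rw [ENNReal.toReal_ofReal (stdDensity_nonneg _), smul_eq_mul]

/-- The Cameron–Martin shift formula. -/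
lemma integral_stdGaussian_add (F : E → ℝ) (v : E) :
    ∫ y, F (y + v) ∂(stdGaussian E)
      = ∫ y, F y * Real.exp (inner ℝ y v - ‖v‖ ^ 2 / 2) ∂(stdGaussian E) := by
  rw [integral_stdGaussian, integral_stdGaussian,
    ← integral_add_right_eq_self (fun y => stdDensity y * (F y * _)) v]
  congr 1 with y
  have : stdDensity (y + v) * Real.exp (inner ℝ (y + v) v - ‖v‖ ^ 2 / 2) = stdDensity y := by
    unfold stdDensity
    rw [mul_assoc, ← Real.exp_add, norm_add_sq_real, inner_add_left, real_inner_self_eq_norm_sq]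
    congr 2
    ring
  rw [← this]
  ring

lemma integrable_exp_mul_norm (c : ℝ) :
    Integrable (fun y => Real.exp (c * ‖y‖)) (stdGaussian E) := by
  obtain ⟨C, hC, h⟩ := IsGaussian.exists_integrable_exp_sq (stdGaussian E)
  refine (h.const_mul (Real.exp (c ^ 2 / (4 * C)))).mono'
    (by fun_prop) (ae_of_all _ fun y => ?_)
  rw [Real.norm_eq_abs, abs_of_pos (Real.exp_pos _), ← Real.exp_add]
  apply Real.exp_le_exp.2
  have : c ^ 2 / (4 * C) + C * ‖y‖ ^ 2 - c * ‖y‖ = C * (‖y‖ - c / (2 * C)) ^ 2 := by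
    field_simp
    ring
  have : 0 ≤ C * (‖y‖ - c / (2 * C)) ^ 2 := by positivity
  linarith

lemma integrable_stdGaussian_of_bounded {F : E → ℝ} (hF : Measurable F) {C : ℝ}
    (hb : ∀ x, |F x| ≤ C) : Integrable F (stdGaussian E) :=
  Integrable.of_bound hF.aestronglyMeasurable C (ae_of_all _ hb)

lemma integrable_norm_stdGaussian : Integrable (fun y : E => ‖y‖) (stdGaussian E) :=
  (IsGaussian.integrable_id (μ := stdGaussian E)).norm

lemma integrable_mul_inner {F : E → ℝ} (hF : Measurable F) {C : ℝ}
    (hb : ∀ x, |F x| ≤ C) (w : E) :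
    Integrable (fun y => F y * inner ℝ y w) (stdGaussian E) := by
  refine Integrable.bdd_mul (c := C) ?_ hF.aestronglyMeasurable (ae_of_all _ hb)
  refine (integrable_norm_stdGaussian.mul_const ‖w‖).mono' (by fun_prop) (ae_of_all _ fun y => ?_)
  exact norm_inner_le_norm y w

/-- Smoothing a bounded function by a Gaussian shift: the derivative. -/
lemma exists_hasFDerivAt_gaussian_smoothing {F : E → ℝ} (hF : Measurable F) {C : ℝ}
    (hb : ∀ x, |F x| ≤ C) (v : E) :
    ∃ L : E →L[ℝ] ℝ, HasFDerivAt (fun v => ∫ y, F (y + v) ∂(stdGaussian E)) L v ∧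
      ∀ w, L w = ∫ y, F (y + v) * inner ℝ y w ∂(stdGaussian E) := by
  -- The shift moves from `F` to the exponential weight, which is smooth in `v` even though `F` is
  -- only measurable.
  simp_rw [integral_stdGaussian_add F]
  have hC : 0 ≤ C := (abs_nonneg _).trans (hb 0)
  let K : E → E → E →L[ℝ] ℝ := fun x y =>
    (F y * Real.exp (inner ℝ y x - ‖x‖ ^ 2 / 2)) • innerSL ℝ (y - x)
  have hKm : Measurable (fun y => K v y) := by
    have h1 : Measurable fun y : E => F y * Real.exp (inner ℝ y v - ‖v‖ ^ 2 / 2) := by fun_prop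
    exact h1.smul ((innerSL ℝ).continuous.comp (continuous_id.sub continuous_const)).measurable
  set M := ‖v‖ + 1 with hM
  have hexp : ∀ x ∈ Metric.ball v 1, ∀ y : E,
      Real.exp (inner ℝ y x - ‖x‖ ^ 2 / 2) ≤ Real.exp (M * ‖y‖) := by
    intro x hx y
    apply Real.exp_le_exp.2
    have h1 := real_inner_le_norm y x
    have h2 : ‖x‖ ≤ M := by
      have := norm_sub_norm_le x v
      rw [mem_ball_iff_norm] at hx
      linarith
    nlinarith [norm_nonneg y, sq_nonneg ‖x‖]
  have hKb : ∀ x ∈ Metric.ball v 1, ∀ y : E,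
      ‖K x y‖ ≤ C * Real.exp ((M + 1) * ‖y‖) * Real.exp M := by
    intro x hx y
    have h2 : ‖x‖ ≤ M := by
      have := norm_sub_norm_le x v
      rw [mem_ball_iff_norm] at hx
      linarith
    simp only [K]
    rw [norm_smul, innerSL_apply_norm, norm_mul, Real.norm_eq_abs, Real.norm_eq_abs,
      abs_of_pos (Real.exp_pos _)]
    have h3 : ‖y - x‖ ≤ Real.exp ‖y‖ * Real.exp M := by
      have := norm_sub_le y x
      rw [← Real.exp_add]
      have := Real.add_one_le_exp (‖y‖ + M)
      linarith
    calc |F y| * Real.exp (inner ℝ y x - ‖x‖ ^ 2 / 2) * ‖y - x‖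
        ≤ C * Real.exp (M * ‖y‖) * (Real.exp ‖y‖ * Real.exp M) := by
          gcongr
          · exact hb y
          · exact Real.exp_le_exp.1 (hexp x hx y)
      _ = _ := by
          have : Real.exp ((M + 1) * ‖y‖) = Real.exp (M * ‖y‖) * Real.exp ‖y‖ := by
            rw [← Real.exp_add]; congr 1; ring
          rw [this]; ring
  have hbint : Integrable (fun y : E => C * Real.exp ((M + 1) * ‖y‖) * Real.exp M)
      (stdGaussian E) := ((integrable_exp_mul_norm _).const_mul _).mul_const _
  have hmain := hasFDerivAt_integral_of_dominated_of_fderiv_le (𝕜 := ℝ) (μ := stdGaussian E)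
    (F := fun x y => F y * Real.exp (inner ℝ y x - ‖x‖ ^ 2 / 2)) (F' := K) (x₀ := v)
    (bound := fun y => C * Real.exp ((M + 1) * ‖y‖) * Real.exp M)
    (Metric.ball_mem_nhds v one_pos)
    (Eventually.of_forall fun x => by
      have : Measurable fun y : E => F y * Real.exp (inner ℝ y x - ‖x‖ ^ 2 / 2) := by fun_prop
      exact this.aestronglyMeasurable)
    (by
      refine ((integrable_exp_mul_norm M).const_mul C).mono' ?_ (ae_of_all _ fun y => ?_)
      · have : Measurable fun y : E => F y * Real.exp (inner ℝ y v - ‖v‖ ^ 2 / 2) := by fun_prop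
        exact this.aestronglyMeasurable
      · rw [norm_mul, Real.norm_eq_abs, Real.norm_eq_abs, abs_of_pos (Real.exp_pos _)]
        gcongr
        · exact hb y
        · exact Real.exp_le_exp.1 (hexp v (Metric.mem_ball_self one_pos) y))
    hKm.aestronglyMeasurable
    (ae_of_all _ fun y x hx => hKb x hx y) hbint
    (ae_of_all _ fun y x _ => by
      have h1 : HasFDerivAt (fun x : E => inner ℝ y x - ‖x‖ ^ 2 / 2) (innerSL ℝ (y - x)) x := by
        have ha : HasFDerivAt (fun x : E => inner ℝ y x) (innerSL ℝ y) x :=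
          (innerSL ℝ y).hasFDerivAt
        have hb' := ((hasStrictFDerivAt_norm_sq x).hasFDerivAt).const_mul (1 / 2 : ℝ)
        refine ((ha.sub hb').congr_fderiv ?_).congr_of_eventuallyEq
          (Eventually.of_forall fun z => ?_)
        · ext z
          simp
        · simp; ring
      have h2 := (h1.exp.const_mul (F y))
      refine h2.congr_fderiv ?_
      simp only [K]
      rw [smul_smul])
  refine ⟨_, hmain, fun w => ?_⟩
  have hKint : Integrable (K v) (stdGaussian E) :=
    hbint.mono' hKm.aestronglyMeasurable
      (ae_of_all _ fun y => hKb v (Metric.mem_ball_self one_pos) y)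
  rw [ContinuousLinearMap.integral_apply hKint]
  -- Undoing the shift turns the weight `y - v` back into `y`.
  have := integral_stdGaussian_add (fun y => F y * inner ℝ (y - v) w) v
  simp only [add_sub_cancel_right] at this
  rw [this]
  congr 1 with y
  simp only [K, smul_apply, innerSL_apply_apply, smul_eq_mul]
  ring

end Calculus

/-! ### Integration by parts and the Mehler (Ornstein–Uhlenbeck) operators. -/

section Mehler

variable {E : Type*} [NormedAddCommGroup E] [InnerProductSpace ℝ E] [FiniteDimensional ℝ E]
  [MeasurableSpace E] [BorelSpace E]

/-- Gaussian integration by parts. -/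
lemma integral_mul_inner_eq_integral_fderiv {g : E → ℝ} (hd : Differentiable ℝ g) {B C : ℝ}
    (hb : ∀ x, |g x| ≤ B) (hL : ∀ x, ‖fderiv ℝ g x‖ ≤ C) (x w : E) (σ : ℝ) :
    ∫ y, g (x + σ • y) * inner ℝ y w ∂(stdGaussian E)
      = σ * ∫ y, fderiv ℝ g (x + σ • y) w ∂(stdGaussian E) := by
  have hgm : Measurable g := hd.continuous.measurable
  -- The mean of `g (x + σ • (y + t • w))` is differentiated at `t = 0` twice: through the Gaussian
  -- weight here, and under the integral sign in `h2`. Uniqueness of the derivative is the claim.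
  obtain ⟨L, hL1, hL2⟩ := exists_hasFDerivAt_gaussian_smoothing (F := fun y => g (x + σ • y))
    (by fun_prop) (fun y => hb _) (0 : E)
  have h1 : HasDerivAt (fun t : ℝ => ∫ y, g (x + σ • (y + t • w)) ∂(stdGaussian E)) (L w) 0 := by
    have hline : HasDerivAt (fun t : ℝ => t • w) w 0 := by
      simpa using (hasDerivAt_id (0 : ℝ)).smul_const w
    have hL1' : HasFDerivAt (fun v => ∫ y, g (x + σ • (y + v)) ∂(stdGaussian E)) L
        ((0 : ℝ) • w) := by simpa using hL1
    exact hL1'.comp_hasDerivAt (0 : ℝ) hline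
  have hC : 0 ≤ C := (norm_nonneg _).trans (hL 0)
  have h2 := (hasDerivAt_integral_of_dominated_loc_of_deriv_le (μ := stdGaussian E) (x₀ := (0 : ℝ))
    (F := fun t y => g (x + σ • (y + t • w)))
    (F' := fun t y => fderiv ℝ g (x + σ • (y + t • w)) (σ • w))
    (bound := fun _ => C * ‖σ • w‖) univ_mem
    (Eventually.of_forall fun t => by
      have : Measurable fun y => g (x + σ • (y + t • w)) := by fun_prop
      exact this.aestronglyMeasurable)
    (integrable_stdGaussian_of_bounded (by fun_prop) (fun y => hb _))
    (by
      have : Measurable fun y => fderiv ℝ g (x + σ • (y + (0 : ℝ) • w)) (σ • w) :=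
        (measurable_fderiv_apply_const ℝ g (σ • w)).comp (by fun_prop)
      exact this.aestronglyMeasurable)
    (ae_of_all _ fun y t _ => ContinuousLinearMap.le_of_opNorm_le _ (hL _) _)
    (integrable_const _)
    (ae_of_all _ fun y t _ => by
      have hline : HasDerivAt (fun t : ℝ => x + σ • (y + t • w)) (σ • w) t := by
        have := (((hasDerivAt_id t).smul_const w).const_add y).const_smul σ |>.const_add x
        simpa using this
      exact (hd _).hasFDerivAt.comp_hasDerivAt t hline)).2
  have h3 := h1.unique h2
  rw [hL2] at h3
  simp only [add_zero, zero_smul, map_smul, smul_eq_mul] at h3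
  rw [h3, integral_const_mul]

lemma exists_cos_sin_of_sq_add_sq {r s : ℝ} (h : r ^ 2 + s ^ 2 = 1) :
    ∃ θ : ℝ, Real.cos θ = r ∧ Real.sin θ = s := by
  have hn : ‖(⟨r, s⟩ : ℂ)‖ = 1 := by
    rw [Complex.norm_def, Complex.normSq_mk, ← sq, ← sq, h, Real.sqrt_one]
  refine ⟨Complex.arg ⟨r, s⟩, ?_, ?_⟩
  · rw [Complex.cos_arg (by rw [← norm_pos_iff, hn]; exact one_pos), hn, div_one]
  · rw [Complex.sin_arg, hn, div_one]

lemma integral_prod_rotate {r s : ℝ} (h : r ^ 2 + s ^ 2 = 1) {H : E × E → ℝ} (hH : Measurable H) :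
    ∫ p, H (r • p.1 + s • p.2, -s • p.1 + r • p.2) ∂((stdGaussian E).prod (stdGaussian E))
      = ∫ p, H p ∂((stdGaussian E).prod (stdGaussian E)) := by
  obtain ⟨θ, rfl, rfl⟩ := exists_cos_sin_of_sq_add_sq h
  have h0 := IsGaussian.map_rotation_eq_self (μ := stdGaussian E) integral_id_stdGaussian θ
  conv_rhs => rw [← h0]
  rw [integral_map (by fun_prop) hH.aestronglyMeasurable]
  rfl

lemma integral_stdGaussian_neg {F : E → ℝ} (hF : Measurable F) :
    ∫ y, F (-y) ∂(stdGaussian E) = ∫ y, F y ∂(stdGaussian E) := by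
  have h : (stdGaussian E).map (LinearIsometryEquiv.neg ℝ) = stdGaussian E :=
    stdGaussian_map (LinearIsometryEquiv.neg ℝ)
  conv_rhs => rw [← h]
  rw [integral_map (by fun_prop) hF.aestronglyMeasurable]
  rfl

/-- The Gaussian average `∫ f (r x + s y) dγ(y)`; for `r ^ 2 + s ^ 2 = 1` this is Mehler's formula
for the Ornstein–Uhlenbeck semigroup. -/
noncomputable def mehler (r s : ℝ) (f : E → ℝ) (x : E) : ℝ :=
  ∫ y, f (r • x + s • y) ∂(stdGaussian E)

lemma measurable_mehler (r s : ℝ) {f : E → ℝ} (hf : Measurable f) : Measurable (mehler r s f) := by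
  have : StronglyMeasurable (fun p : E × E => f (r • p.1 + s • p.2)) :=
    Measurable.stronglyMeasurable (by fun_prop)
  exact (this.integral_prod_right' (ν := stdGaussian E)).measurable

lemma abs_mehler_le (r s : ℝ) {f : E → ℝ} {C : ℝ} (hb : ∀ x, |f x| ≤ C) (x : E) :
    |mehler r s f x| ≤ C := by
  have := norm_integral_le_of_norm_le_const (μ := stdGaussian E)
    (f := fun y => f (r • x + s • y)) (ae_of_all _ fun y => hb _)
  simpa [mehler] using this

lemma integrable_prod_of_bounded {H : E × E → ℝ} (hH : Measurable H) {C : ℝ}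
    (hb : ∀ x, |H x| ≤ C) : Integrable H ((stdGaussian E).prod (stdGaussian E)) :=
  Integrable.of_bound hH.aestronglyMeasurable C (ae_of_all _ hb)

/-- A linear combination of independent standard Gaussian vectors is Gaussian. -/
lemma integral_integral_add_smul {a b σ : ℝ} (h : a ^ 2 + b ^ 2 = σ ^ 2) {F : E → ℝ}
    (hF : Measurable F) {C : ℝ} (hb : ∀ x, |F x| ≤ C) :
    ∫ y, ∫ z, F (a • y + b • z) ∂(stdGaussian E) ∂(stdGaussian E)
      = ∫ y, F (σ • y) ∂(stdGaussian E) := by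
  rcases eq_or_ne σ 0 with rfl | hσ
  · have ha : a = 0 := by nlinarith [sq_nonneg a, sq_nonneg b]
    have hb : b = 0 := by nlinarith [sq_nonneg a, sq_nonneg b]
    simp [ha, hb]
  · have h1 : (a / σ) ^ 2 + (b / σ) ^ 2 = 1 := by
      field_simp
      exact h
    have h2 := integral_prod_rotate h1 (H := fun p : E × E => F (σ • p.1)) (by fun_prop)
    rw [integral_prod _ (integrable_prod_of_bounded (by fun_prop) fun x => hb _),
      integral_prod _ (integrable_prod_of_bounded (by fun_prop) fun x => hb _)] at h2
    simp only [integral_const, probReal_univ, smul_eq_mul, one_mul, smul_add, smul_smul,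
      mul_div_cancel₀ _ hσ] at h2
    exact h2

lemma integral_mehler {r s : ℝ} (h : r ^ 2 + s ^ 2 = 1) {f : E → ℝ} (hf : Measurable f) {C : ℝ}
    (hb : ∀ x, |f x| ≤ C) :
    ∫ x, mehler r s f x ∂(stdGaussian E) = ∫ x, f x ∂(stdGaussian E) := by
  have := integral_integral_add_smul (σ := 1) (by rw [h]; norm_num) hf hb
  simpa [mehler] using this

/-- Reversibility: the pair `(X, r X + s Y)` is exchangeable, because the rotation with parameters
`(r, -s)` followed by `Y ↦ -Y` swaps its two entries. -/
lemma integral_mul_mehler_comm {r s : ℝ} (h : r ^ 2 + s ^ 2 = 1) {f g : E → ℝ} (hf : Measurable f)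
    (hg : Measurable g) {C D : ℝ} (hbf : ∀ x, |f x| ≤ C) (hbg : ∀ x, |g x| ≤ D) :
    ∫ x, f x * mehler r s g x ∂(stdGaussian E) = ∫ x, mehler r s f x * g x ∂(stdGaussian E) := by
  have hC : 0 ≤ C := (abs_nonneg _).trans (hbf 0)
  have h1 : (r ^ 2 + (-s) ^ 2 = 1) := by rw [neg_sq, h]
  have hbd : ∀ u v : E, |f u * g v| ≤ C * D := fun u v => by
    rw [abs_mul]; exact mul_le_mul (hbf _) (hbg _) (abs_nonneg _) hC
  have h2 := integral_prod_rotate h1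
    (H := fun p : E × E => f p.1 * g (r • p.1 + s • p.2)) (by fun_prop)
  rw [integral_prod _ (integrable_prod_of_bounded (by fun_prop) fun x => hbd _ _),
    integral_prod _ (integrable_prod_of_bounded (by fun_prop) fun x => hbd _ _)] at h2
  simp only [mehler, ← integral_const_mul, ← integral_mul_const]
  rw [← h2]
  congr 1 with x
  rw [← integral_stdGaussian_neg (F := fun y => f (r • x + s • y) * g x) (by fun_prop)]
  congr 1 with y
  congr 2
  · simp
  · have : r • (r • x + -s • y) + s • (- -s • x + r • y) = (r ^ 2 + s ^ 2) • x := by module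
    rw [this, h, one_smul]

lemma mehler_mehler {r s r' s' σ : ℝ} (h : (r' * s) ^ 2 + s' ^ 2 = σ ^ 2) {f : E → ℝ}
    (hf : Measurable f) {C : ℝ} (hb : ∀ x, |f x| ≤ C) (x : E) :
    mehler r s (mehler r' s' f) x = mehler (r * r') σ f x := by
  have := integral_integral_add_smul h (F := fun z => f ((r * r') • x + z)) (by fun_prop)
    (fun z => hb _)
  unfold mehler
  rw [← this]
  congr 1 with y
  congr 1 with z
  congr 1
  module

omit [BorelSpace E] in
lemma mehler_eq_smoothing {r s : ℝ} (hs : s ≠ 0) (f : E → ℝ) (x : E) :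
    mehler r s f x = ∫ y, f (s • (y + (r / s) • x)) ∂(stdGaussian E) := by
  unfold mehler
  congr 1 with y
  rw [smul_add, smul_smul, mul_div_cancel₀ _ hs, add_comm]

lemma hasFDerivAt_mehler {r s : ℝ} (hs : s ≠ 0) {f : E → ℝ} (hf : Measurable f) {C : ℝ}
    (hb : ∀ x, |f x| ≤ C) (x : E) :
    ∃ L : E →L[ℝ] ℝ, HasFDerivAt (mehler r s f) L x ∧
      ∀ w, L w = (r / s) * ∫ y, f (r • x + s • y) * inner ℝ y w ∂(stdGaussian E) := by
  obtain ⟨L, h1, h2⟩ := exists_hasFDerivAt_gaussian_smoothing (F := fun y => f (s • y))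
    (by fun_prop) (fun y => hb _) ((r / s) • x)
  refine ⟨(r / s) • L, ?_, fun w => ?_⟩
  · have h3 : HasFDerivAt (fun x : E => (r / s) • x) ((r / s) • ContinuousLinearMap.id ℝ E) x :=
      (hasFDerivAt_id x).const_smul (r / s)
    have h4 := h1.comp x h3
    refine (h4.congr_of_eventuallyEq (Eventually.of_forall fun z => ?_)).congr_fderiv ?_
    · exact mehler_eq_smoothing hs f z
    · ext w; simp
  · rw [smul_apply, h2, smul_eq_mul]
    congr 2 with y
    rw [smul_add, smul_smul, mul_div_cancel₀ _ hs, add_comm]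

lemma differentiable_mehler {r s : ℝ} (hs : s ≠ 0) {f : E → ℝ} (hf : Measurable f) {C : ℝ}
    (hb : ∀ x, |f x| ≤ C) : Differentiable ℝ (mehler r s f) := fun x =>
  (hasFDerivAt_mehler hs hf hb x).choose_spec.1.differentiableAt

lemma fderiv_mehler_apply {r s : ℝ} (hs : s ≠ 0) {f : E → ℝ} (hf : Measurable f) {C : ℝ}
    (hb : ∀ x, |f x| ≤ C) (x w : E) :
    fderiv ℝ (mehler r s f) x w
      = (r / s) * ∫ y, f (r • x + s • y) * inner ℝ y w ∂(stdGaussian E) := by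
  obtain ⟨L, h1, h2⟩ := hasFDerivAt_mehler (r := r) hs hf hb x
  rw [h1.fderiv, h2]

/-- The second moment of `⟨y, w⟩` is `‖w‖ ^ 2`, and the variance of `|⟨y, w⟩|` is nonnegative. -/
lemma integral_abs_inner_le (w : E) : ∫ y, |inner ℝ y w| ∂(stdGaussian E) ≤ ‖w‖ := by
  have hv := variance_dual_stdGaussian (innerSL ℝ w : StrongDual ℝ E)
  have hm := integral_strongDual_stdGaussian (innerSL ℝ w : StrongDual ℝ E)
  have hL2 : MemLp (innerSL ℝ w : StrongDual ℝ E) 2 (stdGaussian E) :=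
    IsGaussian.memLp_dual _ _ _ (by simp)
  rw [variance_of_integral_eq_zero hL2.aestronglyMeasurable.aemeasurable hm,
    innerSL_apply_norm] at hv
  have h1 := variance_nonneg (fun y => |inner ℝ y w|) (stdGaussian E)
  have hL2' : MemLp (fun y => |inner ℝ y w|) 2 (stdGaussian E) := by
    refine hL2.norm.congr_norm (by fun_prop) (ae_of_all _ fun y => ?_)
    simp [real_inner_comm]
  rw [variance_eq_sub hL2'] at h1
  have h2 : (stdGaussian E)[(fun y => |inner ℝ y w|) ^ 2] = ‖w‖ ^ 2 := by
    rw [← hv]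
    congr 1 with y
    simp [real_inner_comm]
  rw [h2] at h1
  exact abs_le_of_sq_le_sq' (by linarith) (norm_nonneg _) |>.2

lemma abs_integral_mul_inner_le {F : E → ℝ} (hF : Measurable F) {C : ℝ} (hb : ∀ x, |F x| ≤ C)
    (w : E) : |∫ y, F y * inner ℝ y w ∂(stdGaussian E)| ≤ C * ‖w‖ := by
  have hC : 0 ≤ C := (abs_nonneg _).trans (hb 0)
  calc |∫ y, F y * inner ℝ y w ∂(stdGaussian E)|
      ≤ ∫ y, |F y * inner ℝ y w| ∂(stdGaussian E) := abs_integral_le_integral_abs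
    _ ≤ ∫ y, C * |inner ℝ y w| ∂(stdGaussian E) := by
        refine integral_mono (integrable_mul_inner hF hb w).abs ?_ fun y => ?_
        · have := (integrable_mul_inner (E := E) (F := fun _ => 1) measurable_const (C := 1)
            (by simp) w).abs.const_mul C
          simpa using this
        · simp only [abs_mul]
          exact mul_le_mul_of_nonneg_right (hb y) (abs_nonneg _)
    _ ≤ C * ‖w‖ := by
        rw [integral_const_mul]
        exact mul_le_mul_of_nonneg_left (integral_abs_inner_le w) hC

lemma norm_fderiv_mehler_le {r s : ℝ} (hs : s ≠ 0) {f : E → ℝ} (hf : Measurable f) {C : ℝ}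
    (hb : ∀ x, |f x| ≤ C) (x : E) : ‖fderiv ℝ (mehler r s f) x‖ ≤ |r / s| * C := by
  have hC : 0 ≤ C := (abs_nonneg _).trans (hb 0)
  refine ContinuousLinearMap.opNorm_le_bound _ (by positivity) fun w => ?_
  rw [fderiv_mehler_apply hs hf hb, norm_mul, Real.norm_eq_abs, Real.norm_eq_abs, mul_assoc]
  exact mul_le_mul_of_nonneg_left
    (abs_integral_mul_inner_le (F := fun y => f (r • x + s • y)) (by fun_prop) (fun _ => hb _) w)
    (abs_nonneg _)

end Mehler

/-! ### The two-point hypercontractive inequality. -/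

section TwoPoint

/-- For `q ∈ [0, 1]`, `(1 + x) ^ q - (1 - x) ^ q ≥ 2 q x` on `[0, 1]`. -/
lemma two_mul_le_rpow_sub_rpow {q x : ℝ} (hq0 : 0 ≤ q) (hq1 : q ≤ 1) (hx0 : 0 ≤ x) (hx1 : x ≤ 1) :
    2 * q * x ≤ (1 + x) ^ q - (1 - x) ^ q := by
  rcases hq0.eq_or_lt with rfl | hq0
  · simp
  have hmono : MonotoneOn (fun x : ℝ => (1 + x) ^ q - (1 - x) ^ q - 2 * q * x) (Set.Icc 0 1) := by
    apply monotoneOn_of_hasDerivWithinAt_nonneg (convex_Icc 0 1)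
      (f' := fun x => q * (1 + x) ^ (q - 1) + q * (1 - x) ^ (q - 1) - 2 * q)
    · refine ContinuousOn.sub (ContinuousOn.sub ?_ ?_) (by fun_prop)
      · exact ContinuousOn.rpow_const (by fun_prop) fun _ _ => Or.inr hq0.le
      · exact ContinuousOn.rpow_const (by fun_prop) fun _ _ => Or.inr hq0.le
    · intro y hy
      rw [interior_Icc] at hy
      have h1 : HasDerivAt (fun x : ℝ => (1 + x) ^ q) (q * (1 + y) ^ (q - 1)) y := by
        have := ((hasDerivAt_id y).const_add 1).rpow_const (p := q)
          (Or.inl (by simp only [id]; linarith [hy.1]))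
        simpa using this
      have h2 : HasDerivAt (fun x : ℝ => (1 - x) ^ q) (-(q * (1 - y) ^ (q - 1))) y := by
        have := ((hasDerivAt_id y).const_sub 1).rpow_const (p := q)
          (Or.inl (by simp only [id]; linarith [hy.2]))
        simpa using this
      have h3 := (h1.sub h2).sub ((hasDerivAt_id y).const_mul (2 * q))
      refine (h3.congr_deriv ?_).hasDerivWithinAt
      simp
    · intro y hy
      rw [interior_Icc] at hy
      have ha : 0 < 1 + y := by linarith [hy.1]
      have hb : 0 < 1 - y := by linarith [hy.2]
      -- The product is `(1 - y²) ^ (q - 1)` with a nonpositive exponent; AM–GM then makes the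
      -- derivative nonnegative.
      have h1 : 1 ≤ (1 + y) ^ (q - 1) * (1 - y) ^ (q - 1) := by
        rw [← Real.mul_rpow ha.le hb.le]
        apply Real.one_le_rpow_of_pos_of_le_one_of_nonpos
        · positivity
        · nlinarith [sq_nonneg y]
        · linarith
      have h2 : 0 < (1 + y) ^ (q - 1) := Real.rpow_pos_of_pos ha _
      have h3 : 0 < (1 - y) ^ (q - 1) := Real.rpow_pos_of_pos hb _
      have h4 : 2 ≤ (1 + y) ^ (q - 1) + (1 - y) ^ (q - 1) := by
        nlinarith [sq_nonneg ((1 + y) ^ (q - 1) - (1 - y) ^ (q - 1))]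
      nlinarith
  have := hmono (Set.left_mem_Icc.2 zero_le_one) ⟨hx0, hx1⟩ hx0
  simp at this
  linarith

/-- There is equality at `x = 0`, and the derivative of the difference is nonnegative by
`two_mul_le_rpow_sub_rpow` with `q = p - 1`. -/
lemma one_add_sq_le_rpow_add_rpow {p x : ℝ} (hp1 : 1 ≤ p) (hp2 : p ≤ 2) (hx0 : 0 ≤ x)
    (hx1 : x ≤ 1) :
    1 + p * (p - 1) / 2 * x ^ 2 ≤ ((1 + x) ^ p + (1 - x) ^ p) / 2 := by
  have hmono : MonotoneOn
      (fun x : ℝ => ((1 + x) ^ p + (1 - x) ^ p) / 2 - p * (p - 1) / 2 * x ^ 2) (Set.Icc 0 1) := by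
    apply monotoneOn_of_hasDerivWithinAt_nonneg (convex_Icc 0 1)
      (f' := fun x => (p * (1 + x) ^ (p - 1) - p * (1 - x) ^ (p - 1)) / 2 - p * (p - 1) * x)
    · refine ContinuousOn.sub (ContinuousOn.div_const (ContinuousOn.add ?_ ?_) _) (by fun_prop)
      · exact ContinuousOn.rpow_const (by fun_prop) fun _ _ => Or.inr (by linarith)
      · exact ContinuousOn.rpow_const (by fun_prop) fun _ _ => Or.inr (by linarith)
    · intro y hy
      have h1 : HasDerivAt (fun x : ℝ => (1 + x) ^ p) (p * (1 + y) ^ (p - 1)) y := by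
        have := ((hasDerivAt_id y).const_add 1).rpow_const (p := p) (Or.inr hp1)
        simpa using this
      have h2 : HasDerivAt (fun x : ℝ => (1 - x) ^ p) (-(p * (1 - y) ^ (p - 1))) y := by
        have := ((hasDerivAt_id y).const_sub 1).rpow_const (p := p) (Or.inr hp1)
        simpa using this
      have h3 := ((h1.add h2).div_const 2).sub ((hasDerivAt_pow 2 y).const_mul (p * (p - 1) / 2))
      refine (h3.congr_deriv ?_).hasDerivWithinAt
      simp
      ring
    · intro y hy
      rw [interior_Icc] at hy
      have := two_mul_le_rpow_sub_rpow (q := p - 1) (by linarith) (by linarith) hy.1.le hy.2.le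
      nlinarith
  have := hmono (Set.left_mem_Icc.2 zero_le_one) ⟨hx0, hx1⟩ hx0
  simp at this
  linarith

/-- The two-point hypercontractive inequality from `L^(1+ρ)` to `L^2`. -/
lemma two_point_hypercontractive {ρ a b : ℝ} (hρ0 : 0 ≤ ρ) (hρ1 : ρ ≤ 1) (ha : 0 ≤ a)
    (hb : 0 ≤ b) :
    √(((a + b) / 2) ^ 2 + ρ * ((a - b) / 2) ^ 2)
      ≤ ((a ^ (1 + ρ) + b ^ (1 + ρ)) / 2) ^ (1 / (1 + ρ)) := by
  wlog hab : b ≤ a generalizing a b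
  · have := this hb ha (le_of_not_ge hab)
    rw [add_comm b a, add_comm (b ^ _) (a ^ _)] at this
    convert this using 4
    ring
  rcases (add_nonneg ha hb).eq_or_lt with h0 | hpos
  · have ha0 : a = 0 := by linarith
    have hb0 : b = 0 := by linarith
    subst ha0 hb0
    simp
    positivity
  set m := (a + b) / 2 with hm
  -- By homogeneity only the values `1 + x` and `1 - x` of mean one matter.
  set x := (a - b) / (a + b) with hx
  have hmpos : 0 < m := by positivity
  have hx0 : 0 ≤ x := div_nonneg (by linarith) hpos.le
  have hx1 : x ≤ 1 := by rw [hx, div_le_one hpos]; linarith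
  have ha' : a = m * (1 + x) := by rw [hm, hx]; field_simp; ring
  have hb' : b = m * (1 - x) := by rw [hm, hx]; field_simp; ring
  have hk : (a - b) / 2 = m * x := by rw [hm, hx]; field_simp
  have hp : 0 < 1 + ρ := by linarith
  have h1 : m ^ 2 + ρ * ((a - b) / 2) ^ 2 = m ^ 2 * (1 + ρ * x ^ 2) := by rw [hk]; ring
  rw [h1, Real.sqrt_mul (sq_nonneg m), Real.sqrt_sq hmpos.le]
  rw [ha', hb', Real.mul_rpow hmpos.le (by linarith), Real.mul_rpow hmpos.le (by linarith),
    ← mul_add, mul_div_assoc, Real.mul_rpow (by positivity) (by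
      have := Real.rpow_nonneg (show 0 ≤ 1 + x by linarith) (1 + ρ)
      have := Real.rpow_nonneg (show 0 ≤ 1 - x by linarith) (1 + ρ)
      positivity), ← Real.rpow_mul hmpos.le, mul_one_div_cancel hp.ne', Real.rpow_one]
  refine mul_le_mul_of_nonneg_left ?_ hmpos.le
  have h2 := one_add_sq_le_rpow_add_rpow (p := 1 + ρ) (by linarith) (by linarith) hx0 hx1
  -- Bernoulli with exponent `(1 + ρ) / 2 ≤ 1` produces exactly the quadratic lower bound `h2`.
  have h3 : (1 + ρ * x ^ 2) ^ ((1 + ρ) / 2) ≤ 1 + (1 + ρ) * (1 + ρ - 1) / 2 * x ^ 2 := by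
    have := rpow_one_add_le_one_add_mul_self (s := ρ * x ^ 2) (p := (1 + ρ) / 2)
      (by nlinarith [sq_nonneg x, mul_nonneg hρ0 (sq_nonneg x)]) (by linarith) (by linarith)
    linarith
  have h0 : 0 ≤ 1 + ρ * x ^ 2 := by positivity
  calc √(1 + ρ * x ^ 2) = ((1 + ρ * x ^ 2) ^ ((1 + ρ) / 2)) ^ (1 / (1 + ρ)) := by
        rw [← Real.rpow_mul h0, Real.sqrt_eq_rpow]
        congr 1
        field_simp
    _ ≤ _ := Real.rpow_le_rpow (by positivity) (h3.trans h2) (by positivity)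

/-- The left side is the product of the means plus `ρ` times the product of the half-differences.
Cauchy–Schwarz gives each factor the weight `√ρ`, where the `L^(1+ρ)` to `L²` bound applies. -/
lemma two_point_pair {ρ a b c d : ℝ} (hρ0 : 0 ≤ ρ) (hρ1 : ρ ≤ 1) (ha : 0 ≤ a)
    (hb : 0 ≤ b) (hc : 0 ≤ c) (hd : 0 ≤ d) :
    (1 + ρ) / 4 * (a * c + b * d) + (1 - ρ) / 4 * (a * d + b * c)
      ≤ ((a ^ (1 + ρ) + b ^ (1 + ρ)) / 2) ^ (1 / (1 + ρ)) *
        ((c ^ (1 + ρ) + d ^ (1 + ρ)) / 2) ^ (1 / (1 + ρ)) := by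
  refine le_trans ?_ (mul_le_mul (two_point_hypercontractive hρ0 hρ1 ha hb)
    (two_point_hypercontractive hρ0 hρ1 hc hd) (Real.sqrt_nonneg _) (by positivity))
  rw [← Real.sqrt_mul (by positivity)]
  apply Real.le_sqrt_of_sq_le
  have : 0 ≤ ρ * ((a + b) / 2 * ((c - d) / 2) - (a - b) / 2 * ((c + d) / 2)) ^ 2 := by positivity
  nlinarith

/-- Infinite values must be allowed, since tensorisation feeds in partial norms that may be
infinite. -/
lemma two_point_pair_ennreal {ρ : ℝ} (hρ0 : 0 ≤ ρ) (hρ1 : ρ ≤ 1) (a b c d : ℝ≥0∞) :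
    ENNReal.ofReal ((1 + ρ) / 4) * (a * c + b * d) + ENNReal.ofReal ((1 - ρ) / 4) * (a * d + b * c)
      ≤ ((a ^ (1 + ρ) + b ^ (1 + ρ)) / 2) ^ (1 / (1 + ρ)) *
        ((c ^ (1 + ρ) + d ^ (1 + ρ)) / 2) ^ (1 / (1 + ρ)) := by
  have hp : 0 < 1 + ρ := by linarith
  have htop : ∀ u v : ℝ≥0∞, u = ⊤ ∨ v = ⊤ →
      ((u ^ (1 + ρ) + v ^ (1 + ρ)) / 2) ^ (1 / (1 + ρ)) = ⊤ := by
    rintro u v (rfl | rfl)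
    · simp [ENNReal.top_rpow_of_pos, hp, ENNReal.top_div]
    · simp [ENNReal.top_rpow_of_pos, hp, ENNReal.top_div]
  have hzero : ∀ u v : ℝ≥0∞, ((u ^ (1 + ρ) + v ^ (1 + ρ)) / 2) ^ (1 / (1 + ρ)) = 0 →
      u = 0 ∧ v = 0 := by
    intro u v h
    simpa [ENNReal.rpow_eq_zero_iff, ENNReal.div_eq_zero_iff, hp, hp.le, not_lt.2 hp.le,
      inv_pos.2 hp, hp.not_gt, (inv_pos.2 hp).not_gt] using h
  by_cases hab : a = ⊤ ∨ b = ⊤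
  · rw [htop a b hab]
    by_cases h0 : ((c ^ (1 + ρ) + d ^ (1 + ρ)) / 2) ^ (1 / (1 + ρ)) = 0
    · obtain ⟨rfl, rfl⟩ := hzero c d h0
      simp
    · rw [ENNReal.top_mul h0]; exact le_top
  by_cases hcd : c = ⊤ ∨ d = ⊤
  · rw [htop c d hcd]
    by_cases h0 : ((a ^ (1 + ρ) + b ^ (1 + ρ)) / 2) ^ (1 / (1 + ρ)) = 0
    · obtain ⟨rfl, rfl⟩ := hzero a b h0
      simp
    · rw [ENNReal.mul_top h0]; exact le_top
  push Not at hab hcd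
  have key := two_point_pair (a := a.toReal) (b := b.toReal) (c := c.toReal) (d := d.toReal)
    hρ0 hρ1 ENNReal.toReal_nonneg ENNReal.toReal_nonneg ENNReal.toReal_nonneg ENNReal.toReal_nonneg
  obtain ⟨ha, hb⟩ := hab
  obtain ⟨hc, hd⟩ := hcd
  lift a to NNReal using ha
  lift b to NNReal using hb
  lift c to NNReal using hc
  lift d to NNReal using hd
  have e1 : ∀ u v : NNReal, (((u : ℝ≥0∞) ^ (1 + ρ) + (v : ℝ≥0∞) ^ (1 + ρ)) / 2) ^ (1 / (1 + ρ))
      = ENNReal.ofReal ((((u : ℝ) ^ (1 + ρ) + (v : ℝ) ^ (1 + ρ)) / 2) ^ (1 / (1 + ρ))) := by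
    intro u v
    rw [← ENNReal.ofReal_rpow_of_nonneg (by positivity) (by positivity),
      ENNReal.ofReal_div_of_pos (by norm_num), ENNReal.ofReal_add (by positivity) (by positivity),
      ← ENNReal.ofReal_rpow_of_nonneg (by positivity) hp.le,
      ← ENNReal.ofReal_rpow_of_nonneg (by positivity) hp.le]
    simp
  rw [e1, e1, ← ENNReal.ofReal_mul (by positivity)]
  refine le_trans (le_of_eq ?_) (ENNReal.ofReal_le_ofReal key)
  have h1ρ : 0 ≤ 1 - ρ := by linarith
  simp only [ENNReal.coe_toReal]
  rw [ENNReal.ofReal_add (by positivity) (by positivity), ENNReal.ofReal_mul (by positivity),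
    ENNReal.ofReal_mul (by positivity), ENNReal.ofReal_add (by positivity) (by positivity),
    ENNReal.ofReal_add (by positivity) (by positivity)]
  simp [ENNReal.ofReal_mul]

end TwoPoint

/-! ### Tensorisation of the bilinear inequality. -/

section PairContractive

variable {E : Type*} [NormedAddCommGroup E] [InnerProductSpace ℝ E] [FiniteDimensional ℝ E]
  [MeasurableSpace E] [BorelSpace E]

/-- The law `ν` of a pair of random vectors `(X, Y)` satisfies
`𝔼 F(X) G(Y) ≤ ‖F(X)‖_p ‖G(Y)‖_p`. -/
def PairContractive (p : ℝ) (ν : Measure (WithLp 2 (E × E))) : Prop :=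
  ∀ F G : E → ℝ≥0∞, Measurable F → Measurable G →
    ∫⁻ z, F z.fst * G z.snd ∂ν
      ≤ (∫⁻ z, F z.fst ^ p ∂ν) ^ (1 / p) * (∫⁻ z, G z.snd ^ p ∂ν) ^ (1 / p)

/-- With the `μ`-summand fixed, the property of `ν` bounds the inner integral by `F' * G'`, the
partial `p`-norms. The property of `μ` applied to these finishes, because their `p`-th powers
integrate to the full ones. -/
lemma PairContractive.conv {p : ℝ} (hp : 0 < p) {μ ν : Measure (WithLp 2 (E × E))} [SFinite μ]
    [SFinite ν] (hμ : PairContractive p μ) (hν : PairContractive p ν) :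
    PairContractive p (μ ∗ ν) := by
  intro F G hF hG
  have hfst : Measurable (fun z : WithLp 2 (E × E) => z.fst) := by fun_prop
  have hsnd : Measurable (fun z : WithLp 2 (E × E) => z.snd) := by fun_prop
  rw [Measure.lintegral_conv (by fun_prop), Measure.lintegral_conv (by fun_prop),
    Measure.lintegral_conv (by fun_prop)]
  set F' : E → ℝ≥0∞ := fun x => (∫⁻ z, F (x + z.fst) ^ p ∂ν) ^ (1 / p) with hF'
  set G' : E → ℝ≥0∞ := fun x => (∫⁻ z, G (x + z.snd) ^ p ∂ν) ^ (1 / p) with hG'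
  have hFm : Measurable F' := by
    refine Measurable.pow_const (Measurable.lintegral_prod_right' (ν := ν)
      (f := fun q : E × WithLp 2 (E × E) => F (q.1 + q.2.fst) ^ p) (by fun_prop)) _
  have hGm : Measurable G' := by
    refine Measurable.pow_const (Measurable.lintegral_prod_right' (ν := ν)
      (f := fun q : E × WithLp 2 (E × E) => G (q.1 + q.2.snd) ^ p) (by fun_prop)) _
  have hFp : ∀ x, F' x ^ p = ∫⁻ z, F (x + z.fst) ^ p ∂ν := fun x => by
    rw [hF', ← ENNReal.rpow_mul, one_div_mul_cancel hp.ne', ENNReal.rpow_one]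
  have hGp : ∀ x, G' x ^ p = ∫⁻ z, G (x + z.snd) ^ p ∂ν := fun x => by
    rw [hG', ← ENNReal.rpow_mul, one_div_mul_cancel hp.ne', ENNReal.rpow_one]
  have h1 := hμ F' G' hFm hGm
  simp only [hFp, hGp] at h1
  refine le_trans (lintegral_mono fun x => ?_) h1
  exact hν (fun y => F (x.fst + y)) (fun y => G (x.snd + y)) (by fun_prop) (by fun_prop)

/-- The law of `(ε e, ε' e)` for `ρ`-correlated signs `ε, ε'`. -/
noncomputable def signPair (ρ : ℝ) (e : E) : Measure (WithLp 2 (E × E)) :=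
  ENNReal.ofReal ((1 + ρ) / 4) • (Measure.dirac (WithLp.toLp 2 (e, e)) +
    Measure.dirac (WithLp.toLp 2 (-e, -e))) +
  ENNReal.ofReal ((1 - ρ) / 4) • (Measure.dirac (WithLp.toLp 2 (e, -e)) +
    Measure.dirac (WithLp.toLp 2 (-e, e)))

omit [InnerProductSpace ℝ E] [FiniteDimensional ℝ E] [BorelSpace E] in
lemma lintegral_signPair (ρ : ℝ) (e : E) {H : WithLp 2 (E × E) → ℝ≥0∞} (hH : Measurable H) :
    ∫⁻ z, H z ∂(signPair ρ e) =
      ENNReal.ofReal ((1 + ρ) / 4) * (H (WithLp.toLp 2 (e, e)) + H (WithLp.toLp 2 (-e, -e))) +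
      ENNReal.ofReal ((1 - ρ) / 4) *
        (H (WithLp.toLp 2 (e, -e)) + H (WithLp.toLp 2 (-e, e))) := by
  simp only [signPair, lintegral_add_measure, lintegral_smul_measure, lintegral_dirac' _ hH,
    smul_eq_mul]

lemma ofReal_quarter_add {ρ : ℝ} (hρ0 : 0 ≤ ρ) (hρ1 : ρ ≤ 1) :
    ENNReal.ofReal ((1 + ρ) / 4) + ENNReal.ofReal ((1 - ρ) / 4) = 1 / 2 := by
  rw [← ENNReal.ofReal_add (by linarith) (by linarith)]
  have : (1 + ρ) / 4 + (1 - ρ) / 4 = 1 / 2 := by ring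
  rw [this, ENNReal.ofReal_div_of_pos (by norm_num)]
  simp

omit [InnerProductSpace ℝ E] [FiniteDimensional ℝ E] [BorelSpace E] in
lemma isProbabilityMeasure_signPair {ρ : ℝ} (hρ0 : 0 ≤ ρ) (hρ1 : ρ ≤ 1) (e : E) :
    IsProbabilityMeasure (signPair ρ e) := by
  constructor
  rw [← lintegral_one, lintegral_signPair _ _ measurable_const, ← add_mul,
    ofReal_quarter_add hρ0 hρ1, one_add_one_eq_two, one_div, ENNReal.inv_mul_cancel] <;> simp

lemma pairContractive_signPair {ρ : ℝ} (hρ0 : 0 ≤ ρ) (hρ1 : ρ ≤ 1) (e : E) :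
    PairContractive (1 + ρ) (signPair ρ e) := by
  intro F G hF hG
  have hfst : Measurable (fun z : WithLp 2 (E × E) => z.fst) := by fun_prop
  have hsnd : Measurable (fun z : WithLp 2 (E × E) => z.snd) := by fun_prop
  rw [lintegral_signPair _ _ (by fun_prop), lintegral_signPair _ _ (by fun_prop),
    lintegral_signPair _ _ (by fun_prop)]
  have h := two_point_pair_ennreal hρ0 hρ1 (F e) (F (-e)) (G e) (G (-e))
  have h2 : ∀ u v : ℝ≥0∞, (u + v) / 2 = ENNReal.ofReal ((1 + ρ) / 4) * (u + v) +
      ENNReal.ofReal ((1 - ρ) / 4) * (u + v) := by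
    intro u v
    rw [← add_mul, ofReal_quarter_add hρ0 hρ1, one_div, mul_comm, div_eq_mul_inv]
  rw [h2, h2] at h
  refine h.trans (le_of_eq ?_)
  simp only [WithLp.toLp_fst, WithLp.toLp_snd]
  rw [add_comm (G (-e) ^ (1 + ρ)) (G e ^ (1 + ρ))]

end PairContractive

/-! ### Central limit theorem and Gaussian hypercontractivity. -/

section CentralLimit

variable {E : Type*} [NormedAddCommGroup E] [InnerProductSpace ℝ E] [FiniteDimensional ℝ E]
  [MeasurableSpace E] [BorelSpace E]

omit [FiniteDimensional ℝ E] [MeasurableSpace E] [BorelSpace E] in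
lemma prod_inner_eq_fst_add_snd (x y : WithLp 2 (E × E)) :
    inner ℝ x y = inner ℝ x.fst y.fst + inner ℝ x.snd y.snd :=
  WithLp.prod_inner_apply x y

lemma charFun_signPair {ρ : ℝ} (hρ0 : 0 ≤ ρ) (hρ1 : ρ ≤ 1) (e : E) (t : WithLp 2 (E × E)) :
    charFun (signPair ρ e) t =
      (((1 + ρ) / 2 * Real.cos (inner ℝ e t.fst + inner ℝ e t.snd) +
        (1 - ρ) / 2 * Real.cos (inner ℝ e t.fst - inner ℝ e t.snd) : ℝ) : ℂ) := by
  have hint : ∀ ν : Measure (WithLp 2 (E × E)), IsFiniteMeasure ν →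
      Integrable (fun z : WithLp 2 (E × E) => Complex.exp ((inner ℝ z t : ℝ) * Complex.I)) ν := by
    intro ν hν
    refine (integrable_const (1 : ℝ)).mono' (by fun_prop) (ae_of_all _ fun z => ?_)
    rw [Complex.norm_exp_ofReal_mul_I]
  have h1 : 0 ≤ (1 + ρ) / 4 := by linarith
  have h2 : 0 ≤ (1 - ρ) / 4 := by linarith
  rw [charFun_apply, signPair, integral_add_measure, integral_smul_measure, integral_smul_measure,
    integral_add_measure, integral_add_measure, integral_dirac, integral_dirac, integral_dirac,
    integral_dirac, ENNReal.toReal_ofReal h1, ENNReal.toReal_ofReal h2]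
  · simp only [prod_inner_eq_fst_add_snd, WithLp.toLp_fst, WithLp.toLp_snd, inner_neg_left, Complex.real_smul]
    push_cast
    rw [Complex.cos, Complex.cos]
    ring_nf
  all_goals first
    | exact hint _ (by infer_instance)
    | exact (hint _ (by infer_instance)).smul_measure ENNReal.ofReal_ne_top

/-- This is the squared slope of `h ↦ sin (h * u)` at zero, sampled at `h = 1 / √N`. -/
lemma tendsto_sin_div_sqrt_mul_sqrt (u : ℝ) :
    Tendsto (fun N : ℕ => (N : ℝ) * Real.sin ((√N)⁻¹ * u) ^ 2) atTop (𝓝 (u ^ 2)) := by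
  have h1 : HasDerivAt (fun h : ℝ => Real.sin (h * u)) u 0 := by
    have := ((hasDerivAt_id (0 : ℝ)).mul_const u).sin
    simpa using this
  have h2 := h1.tendsto_slope_zero
  have h3 : Tendsto (fun N : ℕ => (√N)⁻¹) atTop (𝓝[≠] (0 : ℝ)) := by
    refine tendsto_nhdsWithin_iff.2 ⟨tendsto_inv_atTop_zero.comp
      (Real.tendsto_sqrt_atTop.comp tendsto_natCast_atTop_atTop), ?_⟩
    filter_upwards [eventually_gt_atTop 0] with N hN
    have : (0 : ℝ) < N := by exact_mod_cast hN
    simp only [Set.mem_compl_iff, Set.mem_singleton_iff]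
    positivity
  refine ((h2.comp h3).pow 2).congr fun N => ?_
  simp only [Function.comp_apply, zero_add, zero_mul, Real.sin_zero, sub_zero, inv_inv, smul_eq_mul]
  rw [mul_pow, Real.sq_sqrt (Nat.cast_nonneg N)]

/-- Half-angle formulas write the base as `1 + g N / N` with `g` convergent, so the power tends to
an exponential. -/
lemma tendsto_cos_mix_pow (ρ a b : ℝ) :
    Tendsto (fun N : ℕ => ((1 + ρ) / 2 * Real.cos ((√N)⁻¹ * (a + b)) +
        (1 - ρ) / 2 * Real.cos ((√N)⁻¹ * (a - b))) ^ N) atTop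
      (𝓝 (Real.exp (-(a ^ 2 + 2 * ρ * (a * b) + b ^ 2) / 2))) := by
  have hcos : ∀ x : ℝ, Real.cos x = 1 - 2 * Real.sin (x / 2) ^ 2 := by
    intro x
    have h1 := Real.cos_sq' (x / 2)
    have h2 := Real.cos_two_mul (x / 2)
    rw [mul_div_cancel₀ _ two_ne_zero] at h2
    linarith
  have h := Real.tendsto_one_add_pow_exp_of_tendsto
    (g := fun N : ℕ => -((1 + ρ) * Real.sin ((√N)⁻¹ * ((a + b) / 2)) ^ 2 +
      (1 - ρ) * Real.sin ((√N)⁻¹ * ((a - b) / 2)) ^ 2))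
    (t := -((1 + ρ) * ((a + b) / 2) ^ 2 + (1 - ρ) * ((a - b) / 2) ^ 2)) ?_
  · have e : -((1 + ρ) * ((a + b) / 2) ^ 2 + (1 - ρ) * ((a - b) / 2) ^ 2)
        = -(a ^ 2 + 2 * ρ * (a * b) + b ^ 2) / 2 := by ring
    rw [e] at h
    refine h.congr fun N => ?_
    rw [hcos ((√N)⁻¹ * (a + b)), hcos ((√N)⁻¹ * (a - b)), mul_div_assoc, mul_div_assoc]
    congr 1
    ring
  · refine ((((tendsto_sin_div_sqrt_mul_sqrt ((a + b) / 2)).const_mul (1 + ρ)).add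
      ((tendsto_sin_div_sqrt_mul_sqrt ((a - b) / 2)).const_mul (1 - ρ))).neg).congr fun N => ?_
    ring

/-- The law of the sum of independent `ρ`-correlated pairs of random signs along the vectors of a
list. -/
noncomputable def signPairSum (ρ : ℝ) (l : List E) : Measure (WithLp 2 (E × E)) :=
  l.foldr (fun e m => signPair ρ e ∗ m) (Measure.dirac 0)

lemma isProbabilityMeasure_signPairSum {ρ : ℝ} (hρ0 : 0 ≤ ρ) (hρ1 : ρ ≤ 1) (l : List E) :
    IsProbabilityMeasure (signPairSum ρ l) := by
  induction l with
  | nil => exact Measure.dirac.isProbabilityMeasure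
  | cons e l ih =>
    have := isProbabilityMeasure_signPair hρ0 hρ1 e
    change IsProbabilityMeasure (signPair ρ e ∗ signPairSum ρ l)
    infer_instance

lemma pairContractive_signPairSum {ρ : ℝ} (hρ0 : 0 ≤ ρ) (hρ1 : ρ ≤ 1) (l : List E) :
    PairContractive (1 + ρ) (signPairSum ρ l) := by
  have hp : 0 < 1 + ρ := by linarith
  induction l with
  | nil =>
    intro F G hF hG
    have hfst : Measurable (fun z : WithLp 2 (E × E) => z.fst) := by fun_prop
    have hsnd : Measurable (fun z : WithLp 2 (E × E) => z.snd) := by fun_prop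
    simp only [signPairSum, List.foldr_nil]
    rw [lintegral_dirac' _ (by fun_prop), lintegral_dirac' _ (by fun_prop),
      lintegral_dirac' _ (by fun_prop), ← ENNReal.rpow_mul, ← ENNReal.rpow_mul,
      mul_one_div_cancel hp.ne', ENNReal.rpow_one, ENNReal.rpow_one]
  | cons e l ih =>
    have := isProbabilityMeasure_signPair hρ0 hρ1 e
    have := isProbabilityMeasure_signPairSum hρ0 hρ1 l
    change PairContractive (1 + ρ) (signPair ρ e ∗ signPairSum ρ l)
    exact (pairContractive_signPair hρ0 hρ1 e).conv hp ih

lemma charFun_signPairSum {ρ : ℝ} (hρ0 : 0 ≤ ρ) (hρ1 : ρ ≤ 1) (l : List E)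
    (t : WithLp 2 (E × E)) :
    charFun (signPairSum ρ l) t = (l.map fun e => charFun (signPair ρ e) t).prod := by
  induction l with
  | nil => simp [signPairSum, charFun_dirac]
  | cons e l ih =>
    have := isProbabilityMeasure_signPair hρ0 hρ1 e
    have := isProbabilityMeasure_signPairSum hρ0 hρ1 l
    rw [List.map_cons, List.prod_cons, ← ih]
    change charFun (signPair ρ e ∗ signPairSum ρ l) t = _
    exact charFun_conv _

/-- The law of `(X, ρ X + σ Y)` for independent standard Gaussian vectors `X, Y`. -/
noncomputable def gaussianPair (ρ σ : ℝ) : Measure (WithLp 2 (E × E)) :=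
  ((stdGaussian E).prod (stdGaussian E)).map fun p => WithLp.toLp 2 (p.1, ρ • p.1 + σ • p.2)

lemma isProbabilityMeasure_gaussianPair (ρ σ : ℝ) :
    IsProbabilityMeasure (gaussianPair ρ σ : Measure (WithLp 2 (E × E))) :=
  Measure.isProbabilityMeasure_map (Measurable.aemeasurable (by fun_prop))

lemma charFun_gaussianPair {ρ σ : ℝ} (h : ρ ^ 2 + σ ^ 2 = 1) (t : WithLp 2 (E × E)) :
    charFun (gaussianPair ρ σ) t = Complex.exp
      ((-(‖t.fst‖ ^ 2 + 2 * ρ * inner ℝ t.fst t.snd + ‖t.snd‖ ^ 2) / 2 : ℝ) : ℂ) := by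
  have h1 : charFun (gaussianPair ρ σ) t = charFun
      (((stdGaussian E).prod (stdGaussian E)).map (WithLp.toLp 2))
      (WithLp.toLp 2 (t.fst + ρ • t.snd, σ • t.snd)) := by
    rw [charFun_apply, charFun_apply, gaussianPair,
      integral_map (Measurable.aemeasurable (by fun_prop)) (by fun_prop),
      integral_map (Measurable.aemeasurable (by fun_prop)) (by fun_prop)]
    congr 1 with p
    simp only [prod_inner_eq_fst_add_snd, WithLp.toLp_fst, WithLp.toLp_snd, inner_add_left,
      inner_add_right, real_inner_smul_left, real_inner_smul_right]
    congr 3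
    ring
  rw [h1, charFun_prod, charFun_stdGaussian, charFun_stdGaussian, ← Complex.exp_add]
  congr 1
  have h2 : ‖t.fst + ρ • t.snd‖ ^ 2 + ‖σ • t.snd‖ ^ 2
      = ‖t.fst‖ ^ 2 + 2 * ρ * inner ℝ t.fst t.snd + ‖t.snd‖ ^ 2 := by
    rw [norm_add_sq_real, norm_smul, norm_smul, mul_pow, mul_pow, Real.norm_eq_abs,
      Real.norm_eq_abs, sq_abs, sq_abs, real_inner_smul_right]
    linear_combination ‖t.snd‖ ^ 2 * h
  rw [← h2]
  push_cast
  ring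

/-- Central limit theorem: each basis vector, scaled by `1 / √N`, carries `N` independent pairs of
`ρ`-correlated signs, and the limits multiply over the basis. -/
lemma tendsto_charFun_signPairSum {ρ σ : ℝ} (hρ0 : 0 ≤ ρ) (hρ1 : ρ ≤ 1) (h : ρ ^ 2 + σ ^ 2 = 1)
    {d : ℕ} (b : OrthonormalBasis (Fin d) ℝ E) (t : WithLp 2 (E × E)) :
    Tendsto (fun N : ℕ => charFun (signPairSum ρ
      ((List.finRange d).map fun i => List.replicate N ((√N)⁻¹ • b i)).flatten) t) atTop
      (𝓝 (charFun (gaussianPair ρ σ) t)) := by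
  have h1 : ∀ N : ℕ, charFun (signPairSum ρ
      ((List.finRange d).map fun i => List.replicate N ((√N)⁻¹ • b i)).flatten) t =
      ((∏ i, ((1 + ρ) / 2 * Real.cos ((√N)⁻¹ * (inner ℝ (b i) t.fst + inner ℝ (b i) t.snd)) +
        (1 - ρ) / 2 * Real.cos ((√N)⁻¹ * (inner ℝ (b i) t.fst - inner ℝ (b i) t.snd))) ^ N : ℝ)
          : ℂ) := by
    intro N
    rw [charFun_signPairSum hρ0 hρ1, List.map_flatten, List.prod_flatten, List.map_map,
      List.map_map, Complex.ofReal_prod, Fin.prod_univ_def]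
    congr 2 with i
    simp only [Function.comp_apply, List.map_replicate, List.prod_replicate,
      charFun_signPair hρ0 hρ1, real_inner_smul_left, Complex.ofReal_pow]
    congr 6 <;> ring
  simp_rw [h1]
  rw [charFun_gaussianPair h, ← Complex.ofReal_exp]
  refine (Complex.continuous_ofReal.tendsto _).comp ?_
  have h2 := tendsto_finsetProd (Finset.univ : Finset (Fin d)) fun i _ =>
    tendsto_cos_mix_pow ρ (inner ℝ (b i) t.fst) (inner ℝ (b i) t.snd)
  convert h2 using 2
  rw [← Real.exp_sum]
  congr 1
  rw [← Finset.sum_div, Finset.sum_neg_distrib, Finset.sum_add_distrib, Finset.sum_add_distrib,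
    ← Finset.mul_sum, b.sum_sq_inner_right, b.sum_sq_inner_right]
  congr 5
  rw [← b.sum_inner_mul_inner]
  congr 1 with i
  rw [real_inner_comm]

open scoped NNReal in
/-- Gaussian hypercontractivity, for a pair of `ρ`-correlated Gaussian vectors. -/
lemma lintegral_gaussianPair_le {ρ σ : ℝ} (hρ0 : 0 ≤ ρ) (hρ1 : ρ ≤ 1) (h : ρ ^ 2 + σ ^ 2 = 1)
    {F : E → ℝ≥0} (hF : Continuous F) {C : ℝ≥0} (hb : ∀ x, F x ≤ C) :
    ∫⁻ z, (F z.fst : ℝ≥0∞) * F z.snd ∂(gaussianPair ρ σ)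
      ≤ (∫⁻ z, (F z.fst : ℝ≥0∞) ^ (1 + ρ) ∂(gaussianPair ρ σ)) ^ (1 / (1 + ρ)) *
        (∫⁻ z, (F z.snd : ℝ≥0∞) ^ (1 + ρ) ∂(gaussianPair ρ σ)) ^ (1 / (1 + ρ)) := by
  have hp : 0 < 1 + ρ := by linarith
  let b := stdOrthonormalBasis ℝ E
  let ν : ℕ → ProbabilityMeasure (WithLp 2 (E × E)) := fun N => ⟨signPairSum ρ
      ((List.finRange _).map fun i => List.replicate N ((√N)⁻¹ • b i)).flatten,
      isProbabilityMeasure_signPairSum hρ0 hρ1 _⟩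
  let ν₀ : ProbabilityMeasure (WithLp 2 (E × E)) :=
    ⟨gaussianPair ρ σ, isProbabilityMeasure_gaussianPair ρ σ⟩
  have hν : Tendsto ν atTop (𝓝 ν₀) :=
    ProbabilityMeasure.tendsto_of_tendsto_charFun
      fun t => tendsto_charFun_signPairSum hρ0 hρ1 h b t
  rw [ProbabilityMeasure.tendsto_iff_forall_lintegral_tendsto] at hν
  have hcf : Continuous fun z : WithLp 2 (E × E) => F z.fst := by fun_prop
  have hcs : Continuous fun z : WithLp 2 (E × E) => F z.snd := by fun_prop
  have hbd : ∀ f : WithLp 2 (E × E) → ℝ≥0, ∀ D : ℝ≥0, (∀ z, f z ≤ D) → ∀ x y,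
      dist (f x) (f y) ≤ D := by
    intro f D hf x y
    rw [NNReal.dist_eq, abs_le]
    have h1 : (f x : ℝ) ≤ D := hf x
    have h2 : (f y : ℝ) ≤ D := hf y
    have h3 := (f x).coe_nonneg
    have h4 := (f y).coe_nonneg
    constructor <;> linarith
  have t1 := hν (BoundedContinuousFunction.mkOfBound ⟨fun z => F z.fst * F z.snd, hcf.mul hcs⟩ (C * C)
    (hbd _ (C * C) fun z => mul_le_mul' (hb _) (hb _)))
  have t2 := hν (BoundedContinuousFunction.mkOfBound
    ⟨_, (NNReal.continuous_rpow_const hp.le).comp hcf⟩ _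
    (hbd _ (C ^ (1 + ρ)) fun z => NNReal.rpow_le_rpow (hb _) hp.le))
  have t3 := hν (BoundedContinuousFunction.mkOfBound
    ⟨_, (NNReal.continuous_rpow_const hp.le).comp hcs⟩ _
    (hbd _ (C ^ (1 + ρ)) fun z => NNReal.rpow_le_rpow (hb _) hp.le))
  simp only [BoundedContinuousFunction.mkOfBound_coe, ContinuousMap.coe_mk, Function.comp_apply,
    ENNReal.coe_rpow_of_nonneg _ hp.le] at t1 t2 t3
  -- Finite limits are needed for the product to be continuous there, as multiplication on `[0, ∞]`
  -- is discontinuous at `0 * ∞`.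
  have hfin : ∀ f : WithLp 2 (E × E) → ℝ≥0, (∀ z, f z ≤ C) →
      (∫⁻ z, (f z : ℝ≥0∞) ^ (1 + ρ) ∂(ν₀ : Measure (WithLp 2 (E × E)))) ^ (1 / (1 + ρ)) ≠ ⊤ := by
    intro f hf
    refine ENNReal.rpow_ne_top_of_nonneg (by positivity) (ne_of_lt ?_)
    calc ∫⁻ z, (f z : ℝ≥0∞) ^ (1 + ρ) ∂(ν₀ : Measure (WithLp 2 (E × E)))
        ≤ ∫⁻ z, (C : ℝ≥0∞) ^ (1 + ρ) ∂(ν₀ : Measure (WithLp 2 (E × E))) :=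
          lintegral_mono fun z => ENNReal.rpow_le_rpow (by exact_mod_cast hf z) hp.le
      _ < ⊤ := by
          rw [lintegral_const, measure_univ, mul_one]
          exact ENNReal.rpow_lt_top_of_nonneg hp.le ENNReal.coe_ne_top
  refine le_of_tendsto_of_tendsto' t1 (ENNReal.Tendsto.mul (t2.ennrpow_const _)
    (Or.inr (hfin _ fun z => hb _)) (t3.ennrpow_const _) (Or.inr (hfin _ fun z => hb _)))
    fun N => ?_
  have hFm : Measurable fun x => (F x : ℝ≥0∞) := by fun_prop
  exact pairContractive_signPairSum hρ0 hρ1 _ _ _ hFm hFm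

/-- Gaussian hypercontractivity for the Mehler semigroup. -/
lemma integral_mul_mehler_le {ρ σ : ℝ} (hρ0 : 0 ≤ ρ) (hρ1 : ρ ≤ 1) (h : ρ ^ 2 + σ ^ 2 = 1)
    {f : E → ℝ} (hf : Continuous f) {C : ℝ} (hb : ∀ x, |f x| ≤ C) :
    ∫ x, f x * mehler ρ σ f x ∂(stdGaussian E)
      ≤ (∫ x, |f x| ^ (1 + ρ) ∂(stdGaussian E)) ^ (2 / (1 + ρ)) := by
  have hp : 0 < 1 + ρ := by linarith
  have hC : 0 ≤ C := (abs_nonneg _).trans (hb 0)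
  have hfm : Measurable f := hf.measurable
  set q : E × E → E := fun p => ρ • p.1 + σ • p.2 with hq
  have hfst : Measurable (fun z : WithLp 2 (E × E) => z.fst) := by fun_prop
  have hsnd : Measurable (fun z : WithLp 2 (E × E) => z.snd) := by fun_prop
  have hpair : ∀ H : WithLp 2 (E × E) → ℝ≥0∞, Measurable H → ∫⁻ z, H z ∂(gaussianPair ρ σ)
      = ∫⁻ p, H (WithLp.toLp 2 (p.1, q p)) ∂((stdGaussian E).prod (stdGaussian E)) :=
    fun H hH => lintegral_map hH (by fun_prop)
  have hbd : ∀ x y : E, |f x * f y| ≤ C * C := fun x y => by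
    rw [abs_mul]; exact mul_le_mul (hb _) (hb _) (abs_nonneg _) hC
  have hpow : ∀ x, |(|f x| ^ (1 + ρ))| ≤ C ^ (1 + ρ) := fun x => by
    rw [abs_of_nonneg (by positivity)]
    exact Real.rpow_le_rpow (abs_nonneg _) (hb x) hp.le
  set I := ∫ x, |f x| ^ (1 + ρ) ∂(stdGaussian E) with hI
  have hI0 : 0 ≤ I := integral_nonneg fun x => by positivity
  have m1 : ∫ p : E × E, |f p.1| ^ (1 + ρ) ∂((stdGaussian E).prod (stdGaussian E)) = I := by
    rw [integral_prod _ (integrable_prod_of_bounded (by fun_prop) fun x => hpow _)]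
    simp [hI]
  have m2 : ∫ p : E × E, |f (q p)| ^ (1 + ρ) ∂((stdGaussian E).prod (stdGaussian E)) = I := by
    rw [← m1, hq]
    exact integral_prod_rotate h (H := fun p : E × E => |f p.1| ^ (1 + ρ)) (by fun_prop)
  -- Both marginals are standard Gaussian (`m1`, `m2`), so the two norms of `|f|` coincide and their
  -- exponents add to `2 / (1 + ρ)`.
  have key := lintegral_gaussianPair_le hρ0 hρ1 h (F := fun x => ‖f x‖₊) (by fun_prop)
    (C := ⟨C, hC⟩) (fun x => hb x)
  rw [hpair _ (by fun_prop), hpair _ (by fun_prop), hpair _ (by fun_prop)] at key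
  simp only [WithLp.toLp_fst, WithLp.toLp_snd] at key
  have e1 : ∀ x : E, ((‖f x‖₊ : ℝ≥0∞)) ^ (1 + ρ) = ENNReal.ofReal (|f x| ^ (1 + ρ)) := fun x => by
    rw [← ENNReal.ofReal_rpow_of_nonneg (abs_nonneg _) hp.le, ← Real.norm_eq_abs,
      ofReal_norm]
    rfl
  have e2 : ∀ x y : E, (‖f x‖₊ : ℝ≥0∞) * ‖f y‖₊ = ENNReal.ofReal |f x * f y| := fun x y => by
    rw [← Real.norm_eq_abs, ofReal_norm, enorm_mul]
    rfl
  simp only [e1, e2] at key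
  rw [← ofReal_integral_eq_lintegral_ofReal
      (integrable_prod_of_bounded (by fun_prop) fun x => hpow _)
      (ae_of_all _ fun _ => by positivity),
    ← ofReal_integral_eq_lintegral_ofReal
      (integrable_prod_of_bounded (by fun_prop) fun x => hpow _)
      (ae_of_all _ fun _ => by positivity),
    ← ofReal_integral_eq_lintegral_ofReal
      (integrable_prod_of_bounded (by fun_prop) (C := C * C) fun x => by
        rw [abs_abs]; exact hbd _ _)
      (ae_of_all _ fun _ => abs_nonneg _), m1, m2,
    ENNReal.ofReal_rpow_of_nonneg hI0 (by positivity), ← ENNReal.ofReal_mul (by positivity),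
    ENNReal.ofReal_le_ofReal_iff (by positivity), ← Real.rpow_add_of_nonneg hI0 (by positivity)
      (by positivity), ← add_div, one_add_one_eq_two] at key
  refine le_trans ?_ key
  have e3 : ∫ x, f x * mehler ρ σ f x ∂(stdGaussian E)
      = ∫ p : E × E, f p.1 * f (q p) ∂((stdGaussian E).prod (stdGaussian E)) := by
    rw [integral_prod _ (integrable_prod_of_bounded (by fun_prop) fun x => hbd _ _)]
    simp only [mehler, ← integral_const_mul, hq]
  rw [e3]
  exact (le_abs_self _).trans abs_integral_le_integral_abs

end CentralLimit

/-! ### Rotation interpolation and the `L¹` Talagrand inequality. -/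

section Interpolation

variable {E : Type*} [NormedAddCommGroup E] [InnerProductSpace ℝ E] [FiniteDimensional ℝ E]
  [MeasurableSpace E] [BorelSpace E]

omit [FiniteDimensional ℝ E] [MeasurableSpace E] [BorelSpace E] in
lemma abs_fderiv_apply_le {g : E → ℝ} {C : ℝ} (hL : ∀ x, ‖fderiv ℝ g x‖ ≤ C) (x w : E) :
    |fderiv ℝ g x w| ≤ C * ‖w‖ :=
  ContinuousLinearMap.le_of_opNorm_le _ (hL x) w

lemma integral_abs_mehler_le {r s : ℝ} (h : r ^ 2 + s ^ 2 = 1) {f : E → ℝ} (hf : Measurable f)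
    {C : ℝ} (hb : ∀ x, |f x| ≤ C) :
    ∫ x, |mehler r s f x| ∂(stdGaussian E) ≤ ∫ x, |f x| ∂(stdGaussian E) := by
  have hb' : ∀ x, |(|f x|)| ≤ C := fun x => by rw [abs_abs]; exact hb x
  have hfm : Measurable fun x => |f x| := by fun_prop
  rw [← integral_mehler h hfm hb']
  refine integral_mono ?_ ?_ fun x => abs_integral_le_integral_abs
  · exact (integrable_stdGaussian_of_bounded (measurable_mehler r s hf) (abs_mehler_le r s hb)).abs
  · exact integrable_stdGaussian_of_bounded (measurable_mehler r s hfm) (abs_mehler_le r s hb')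

/-- Interpolation between `L¹` and `L^∞`: the exponent of `K` is `2 r / (1 + r) ≤ 1`, which `K ≥ 1`
allows to be rounded up. -/
lemma integral_rpow_le {r K J : ℝ} (hr0 : 0 ≤ r) (hr1 : r ≤ 1) (hK : 1 ≤ K) {f : E → ℝ}
    (hf : Measurable f) (hb : ∀ x, |f x| ≤ K) (hJ : ∫ x, |f x| ∂(stdGaussian E) ≤ J) :
    (∫ x, |f x| ^ (1 + r) ∂(stdGaussian E)) ^ (2 / (1 + r)) ≤ K * J ^ (2 / (1 + r)) := by
  have hJ0 : 0 ≤ J := (integral_nonneg fun x => abs_nonneg _).trans hJ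
  have hK0 : 0 < K := by linarith
  have h1 : ∫ x, |f x| ^ (1 + r) ∂(stdGaussian E) ≤ K ^ r * J := by
    calc ∫ x, |f x| ^ (1 + r) ∂(stdGaussian E) ≤ ∫ x, K ^ r * |f x| ∂(stdGaussian E) := by
          refine integral_mono_of_nonneg (ae_of_all _ fun x => by positivity)
            ((integrable_stdGaussian_of_bounded hf hb).abs.const_mul _) (ae_of_all _ fun x => ?_)
          simp only
          rw [Real.rpow_add_of_nonneg (abs_nonneg _) zero_le_one hr0, Real.rpow_one, mul_comm]
          exact mul_le_mul_of_nonneg_right (Real.rpow_le_rpow (abs_nonneg _) (hb x) hr0)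
            (abs_nonneg _)
      _ ≤ K ^ r * J := by
          rw [integral_const_mul]
          exact mul_le_mul_of_nonneg_left hJ (by positivity)
  calc (∫ x, |f x| ^ (1 + r) ∂(stdGaussian E)) ^ (2 / (1 + r))
      ≤ (K ^ r * J) ^ (2 / (1 + r)) :=
        Real.rpow_le_rpow (integral_nonneg fun x => by positivity) h1 (by positivity)
    _ = K ^ (r * (2 / (1 + r))) * J ^ (2 / (1 + r)) := by
        rw [Real.mul_rpow (by positivity) hJ0, ← Real.rpow_mul hK0.le]
    _ ≤ K * J ^ (2 / (1 + r)) := by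
        refine mul_le_mul_of_nonneg_right ?_ (by positivity)
        conv_rhs => rw [← Real.rpow_one K]
        refine Real.rpow_le_rpow_of_exponent_le hK ?_
        rw [← mul_div_assoc, div_le_one (by linarith)]
        linarith

/-- The correlation of a derivative with its Mehler average, bounded through its `L¹` norm. -/
lemma integral_fderiv_mul_mehler_le {g : E → ℝ} (hd : Differentiable ℝ g) {C : ℝ}
    (hb : ∀ x, |g x| ≤ 1) (hL : ∀ x, ‖fderiv ℝ g x‖ ≤ C) {w : E} (hw : ‖w‖ = 1) {J L : ℝ}
    (hJ : ∫ x, |fderiv ℝ g x w| ∂(stdGaussian E) ≤ J) (hL0 : 0 ≤ L) (hJL : J ≤ Real.exp (-L))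
    {ρ s : ℝ} (hρ0 : 0 < ρ) (hρ1 : ρ < 1) (h : ρ ^ 2 + s ^ 2 = 1) :
    ∫ x, fderiv ℝ g x w * mehler ρ s (fun y => fderiv ℝ g y w) x ∂(stdGaussian E)
      ≤ √3 / √(1 - ρ) * (J * Real.exp (-(L * (1 - ρ) / 6))) := by
  set a : E → ℝ := fun y => fderiv ℝ g y w with ha
  have ham : Measurable a := measurable_fderiv_apply_const ℝ g w
  have hab : ∀ x, |a x| ≤ C := fun x => by
    have := abs_fderiv_apply_le hL x w
    rwa [hw, mul_one] at this
  have hJ0 : 0 ≤ J := (integral_nonneg fun x => abs_nonneg _).trans hJ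
  set r : ℝ := ρ ^ (1 / 3 : ℝ) with hr
  have hr0 : 0 < r := Real.rpow_pos_of_pos hρ0 _
  have hr1 : r < 1 := Real.rpow_lt_one hρ0.le hρ1 (by norm_num)
  have hr3 : r * (r * r) = ρ := by
    have : r ^ 3 = ρ := by
      rw [hr, ← Real.rpow_natCast, ← Real.rpow_mul hρ0.le]; norm_num
    linarith [this, pow_succ r 2, sq r]
  have hrr : r * r < 1 := by nlinarith
  set t : ℝ := √(1 - r * r) with ht
  have ht0 : 0 < t := Real.sqrt_pos.2 (by linarith)
  have ht2 : t ^ 2 = 1 - r * r := Real.sq_sqrt (by linarith)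
  have hrt : r ^ 2 + t ^ 2 = 1 := by rw [ht2]; ring
  have hr4 : (r * r) * (r * r) ≤ 1 := by nlinarith
  set σ : ℝ := √(1 - (r * r) * (r * r)) with hσ
  have hσ2 : σ ^ 2 = 1 - (r * r) * (r * r) := Real.sq_sqrt (by linarith)
  have e1 : mehler r t (mehler r t a) = mehler (r * r) σ a :=
    funext fun x => mehler_mehler (by rw [mul_pow, ht2, hσ2]; ring) ham hab x
  have e2 : mehler r t (mehler (r * r) σ a) = mehler ρ s a := by
    rw [← hr3]
    refine funext fun x => mehler_mehler ?_ ham hab x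
    have : s ^ 2 = 1 - (r * (r * r)) ^ 2 := by rw [hr3]; linarith
    rw [mul_pow, ht2, hσ2, this]
    ring
  set b : E → ℝ := mehler r t a with hbdef
  have hbm : Measurable b := measurable_mehler r t ham
  have hbC : ∀ x, |b x| ≤ C := abs_mehler_le r t hab
  -- Integration by parts moves the derivative off `g`, so the bound uses only `|g| ≤ 1` and not the
  -- Lipschitz constant `C`.
  have hbK : ∀ x, |b x| ≤ 1 / t := fun x => by
    have h1 := integral_mul_inner_eq_integral_fderiv hd hb hL (r • x) w t
    have h2 := abs_integral_mul_inner_le (F := fun y => g (r • x + t • y))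
      (by have := hd.continuous.measurable; fun_prop) (fun y => hb _) w
    rw [h1, hw, abs_mul, abs_of_pos ht0] at h2
    rw [le_div_iff₀ ht0, mul_comm]
    simpa [hbdef, mehler, ha] using h2
  have hbJ : ∫ x, |b x| ∂(stdGaussian E) ≤ J := (integral_abs_mehler_le hrt ham hab).trans hJ
  have hbc : Continuous b := (differentiable_mehler ht0.ne' ham hab).continuous
  have e3 : ∫ x, a x * mehler ρ s a x ∂(stdGaussian E)
      = ∫ x, b x * mehler r t b x ∂(stdGaussian E) := by
    rw [← e2, ← e1, integral_mul_mehler_comm hrt ham (measurable_mehler r t hbm) hab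
      (abs_mehler_le r t hbC)]
  rw [e3]
  have ht1 : 1 ≤ 1 / t := by
    rw [le_div_iff₀ ht0]
    nlinarith
  refine (integral_mul_mehler_le hr0.le hr1.le hrt hbc hbC).trans
    ((integral_rpow_le hr0.le hr1.le ht1 hbm hbK hbJ).trans ?_)
  -- From `1 - r³ ≤ 3 (1 - r)` come the `√3`, and with `1 + r ≤ 2` the `6` in the exponent.
  have h1r : (1 - ρ) / 3 ≤ 1 - r := by
    rw [← hr3]
    nlinarith [mul_nonneg hr0.le (sub_nonneg.2 hr1.le),
      mul_nonneg (mul_nonneg hr0.le hr0.le) (sub_nonneg.2 hr1.le)]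
  refine mul_le_mul ?_ ?_ (by positivity) (by positivity)
  · rw [div_le_div_iff₀ ht0 (Real.sqrt_pos.2 (by linarith)), one_mul, ht,
      ← Real.sqrt_mul (by norm_num)]
    apply Real.sqrt_le_sqrt
    nlinarith
  · rcases hJ0.eq_or_lt with h0 | hJpos
    · rw [← h0, Real.zero_rpow (by positivity), zero_mul]
    have h2 : 2 / (1 + r) = 1 + (1 - r) / (1 + r) := by field_simp; ring
    rw [h2, Real.rpow_add hJpos, Real.rpow_one]
    refine mul_le_mul_of_nonneg_left ?_ hJ0
    calc J ^ ((1 - r) / (1 + r)) ≤ Real.exp (-L) ^ ((1 - r) / (1 + r)) :=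
          Real.rpow_le_rpow hJ0 hJL (div_nonneg (by linarith) (by linarith))
      _ = Real.exp (-(L * ((1 - r) / (1 + r)))) := by
          rw [← Real.exp_mul]; ring_nf
      _ ≤ Real.exp (-(L * (1 - ρ) / 6)) := by
          apply Real.exp_le_exp.2
          have h3 : (1 - ρ) / 6 ≤ (1 - r) / (1 + r) := by
            rw [div_le_div_iff₀ (by norm_num) (by linarith)]
            nlinarith
          have := mul_le_mul_of_nonneg_left h3 hL0
          linarith

lemma mehler_neg (r s : ℝ) {f : E → ℝ} (hf : Measurable f) : mehler r (-s) f = mehler r s f := by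
  funext x
  unfold mehler
  rw [← integral_stdGaussian_neg (F := fun y => f (r • x + s • y)) (by fun_prop)]
  simp

lemma integrable_norm_fst_add_norm_snd :
    Integrable (fun p : E × E => ‖p.1‖ + ‖p.2‖) ((stdGaussian E).prod (stdGaussian E)) :=
  (integrable_norm_stdGaussian.comp_fst _).add (integrable_norm_stdGaussian.comp_snd _)

omit [FiniteDimensional ℝ E] [MeasurableSpace E] [BorelSpace E] in
lemma fderiv_apply_eq_sum {d : ℕ} (b : OrthonormalBasis (Fin d) ℝ E) (g : E → ℝ) (z w : E) :
    fderiv ℝ g z w = ∑ i, inner ℝ w (b i) * fderiv ℝ g z (b i) := by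
  conv_lhs => rw [← b.sum_repr' w]
  simp only [map_sum, map_smul, smul_eq_mul, real_inner_comm]

/-- The derivative of the covariance along the rotation interpolation. -/
lemma hasDerivAt_integral_mul_rotation {g : E → ℝ} (hd : Differentiable ℝ g) {C : ℝ}
    (hb : ∀ x, |g x| ≤ 1) (hL : ∀ x, ‖fderiv ℝ g x‖ ≤ C) {d : ℕ}
    (b : OrthonormalBasis (Fin d) ℝ E) (θ : ℝ) :
    HasDerivAt (fun θ => ∫ p : E × E, g p.1 * g (Real.cos θ • p.1 + Real.sin θ • p.2)
        ∂((stdGaussian E).prod (stdGaussian E)))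
      (-(Real.sin θ * ∑ i, ∫ x, fderiv ℝ g x (b i) *
        mehler (Real.cos θ) (Real.sin θ) (fun y => fderiv ℝ g y (b i)) x ∂(stdGaussian E))) θ := by
  have hgm : Measurable g := hd.continuous.measurable
  have hC : 0 ≤ C := (norm_nonneg _).trans (hL 0)
  have ham : ∀ i, Measurable fun x => fderiv ℝ g x (b i) :=
    fun i => measurable_fderiv_apply_const ℝ g (b i)
  have hab : ∀ i x, |fderiv ℝ g x (b i)| ≤ C := fun i x => by
    have := abs_fderiv_apply_le hL x (b i)
    rwa [b.norm_eq_one, mul_one] at this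
  have hDm : Measurable fun p : E × E => fderiv ℝ g p.1 p.2 := by
    have hsum : (fun p : E × E => fderiv ℝ g p.1 p.2)
        = fun p => ∑ i, inner ℝ p.2 (b i) * fderiv ℝ g p.1 (b i) :=
      funext fun p => fderiv_apply_eq_sum b g p.1 p.2
    rw [hsum]
    exact Finset.measurable_fun_sum _ fun i _ =>
      (by fun_prop : Measurable fun p : E × E => (inner ℝ p.2 (b i) : ℝ)).mul
        ((ham i).comp measurable_fst)
  have hderiv := (hasDerivAt_integral_of_dominated_loc_of_deriv_le
    (μ := (stdGaussian E).prod (stdGaussian E)) (x₀ := θ)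
    (F := fun θ p => g p.1 * g (Real.cos θ • p.1 + Real.sin θ • p.2))
    (F' := fun θ p => g p.1 * fderiv ℝ g (Real.cos θ • p.1 + Real.sin θ • p.2)
      (-Real.sin θ • p.1 + Real.cos θ • p.2))
    (bound := fun p => C * (‖p.1‖ + ‖p.2‖)) univ_mem
    (Eventually.of_forall fun t => by
      have : Measurable fun p : E × E => g p.1 * g (Real.cos t • p.1 + Real.sin t • p.2) := by
        fun_prop
      exact this.aestronglyMeasurable)
    (integrable_prod_of_bounded (by fun_prop) (C := 1) fun p => by
      rw [abs_mul]; exact mul_le_one₀ (hb _) (abs_nonneg _) (hb _))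
    (by
      have h1 : Measurable fun p : E × E => fderiv ℝ g (Real.cos θ • p.1 + Real.sin θ • p.2)
          (-Real.sin θ • p.1 + Real.cos θ • p.2) :=
        hDm.comp (g := fun p : E × E => fderiv ℝ g p.1 p.2)
          (f := fun p : E × E => (Real.cos θ • p.1 + Real.sin θ • p.2,
            -Real.sin θ • p.1 + Real.cos θ • p.2)) (by fun_prop)
      exact ((hgm.comp measurable_fst).mul h1).aestronglyMeasurable)
    (ae_of_all _ fun p t _ => by
      rw [norm_mul, Real.norm_eq_abs, Real.norm_eq_abs]
      calc |g p.1| * |fderiv ℝ g (Real.cos t • p.1 + Real.sin t • p.2)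
            (-Real.sin t • p.1 + Real.cos t • p.2)|
          ≤ 1 * (C * ‖-Real.sin t • p.1 + Real.cos t • p.2‖) :=
            mul_le_mul (hb _) (abs_fderiv_apply_le hL _ _) (abs_nonneg _) zero_le_one
        _ ≤ C * (‖p.1‖ + ‖p.2‖) := by
            rw [one_mul]
            refine mul_le_mul_of_nonneg_left ((norm_add_le _ _).trans ?_) hC
            rw [norm_smul, norm_smul, norm_neg, Real.norm_eq_abs, Real.norm_eq_abs]
            exact add_le_add (mul_le_of_le_one_left (norm_nonneg _) (Real.abs_sin_le_one t))
              (mul_le_of_le_one_left (norm_nonneg _) (Real.abs_cos_le_one t)))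
    (integrable_norm_fst_add_norm_snd.const_mul C)
    (ae_of_all _ fun p t _ => by
      have h1 := ((Real.hasDerivAt_cos t).smul_const p.1).add
        ((Real.hasDerivAt_sin t).smul_const p.2)
      exact ((hd _).hasFDerivAt.comp_hasDerivAt t h1).const_mul _)).2
  refine hderiv.congr_deriv ?_
  set c := Real.cos θ with hc
  set s := Real.sin θ with hs
  have hcs : c ^ 2 + s ^ 2 = 1 := Real.cos_sq_add_sin_sq θ
  have hHm : Measurable fun p : E × E => g (c • p.1 + -s • p.2) * fderiv ℝ g p.1 p.2 :=
    Measurable.mul (by fun_prop) hDm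
  -- In the rotated variables `z, w` the derivative is `fderiv ℝ g z w`, linear in `w`, and the
  -- other point is `c • z - s • w`. Integrating by parts in `w` produces the factor `-s`.
  have hrot := integral_prod_rotate hcs hHm
  have e1 : ∀ p : E × E, c • (c • p.1 + s • p.2) + -s • (-s • p.1 + c • p.2) = p.1 := by
    intro p
    have : c • (c • p.1 + s • p.2) + -s • (-s • p.1 + c • p.2) = (c ^ 2 + s ^ 2) • p.1 := by
      module
    rw [this, hcs, one_smul]
  simp only [e1] at hrot
  rw [hrot]
  have hHint : Integrable (fun p : E × E => g (c • p.1 + -s • p.2) * fderiv ℝ g p.1 p.2)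
      ((stdGaussian E).prod (stdGaussian E)) := by
    refine ((integrable_norm_stdGaussian.comp_snd _).const_mul C).mono' hHm.aestronglyMeasurable
      (ae_of_all _ fun p => ?_)
    rw [norm_mul, Real.norm_eq_abs, Real.norm_eq_abs, ← one_mul (C * ‖p.2‖)]
    exact mul_le_mul (hb _) (abs_fderiv_apply_le hL _ _) (abs_nonneg _) zero_le_one
  rw [integral_prod _ hHint]
  have e2 : ∀ z : E, ∫ w, g (c • z + -s • w) * fderiv ℝ g z w ∂(stdGaussian E)
      = ∑ i, -s * (fderiv ℝ g z (b i) * mehler c s (fun y => fderiv ℝ g y (b i)) z) := by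
    intro z
    have e3 : ∀ w : E, g (c • z + -s • w) * fderiv ℝ g z w
        = ∑ i, fderiv ℝ g z (b i) * (g (c • z + -s • w) * inner ℝ w (b i)) := by
      intro w
      rw [fderiv_apply_eq_sum b g z w, Finset.mul_sum]
      refine Finset.sum_congr rfl fun i _ => by ring
    simp_rw [e3]
    rw [integral_finsetSum _ fun i _ =>
      (integrable_mul_inner (F := fun w => g (c • z + -s • w)) (by fun_prop)
        (fun _ => hb _) (b i)).const_mul _]
    refine Finset.sum_congr rfl fun i _ => ?_
    rw [integral_const_mul, integral_mul_inner_eq_integral_fderiv hd hb hL,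
      ← mehler_neg c s (ham i)]
    unfold mehler
    ring
  simp_rw [e2]
  rw [integral_finsetSum _ fun i _ => ?_]
  · simp_rw [integral_const_mul]
    rw [← Finset.mul_sum]
    ring
  · refine Integrable.const_mul ?_ _
    refine integrable_stdGaussian_of_bounded ((ham i).mul (measurable_mehler c s (ham i)))
      (C := C * C) fun x => ?_
    rw [abs_mul]
    exact mul_le_mul (hab i x) (abs_mehler_le c s (hab i) x) (abs_nonneg _) hC

/-- An `L¹` version of Talagrand's variance inequality for the standard Gaussian measure. -/
lemma variance_le_sum_of_integral_abs_fderiv_le {g : E → ℝ} (hd : Differentiable ℝ g) {C : ℝ}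
    (hb : ∀ x, |g x| ≤ 1) (hL : ∀ x, ‖fderiv ℝ g x‖ ≤ C) {d : ℕ}
    (b : OrthonormalBasis (Fin d) ℝ E) {J : Fin d → ℝ} {L : ℝ} (hL0 : 0 < L)
    (hJ : ∀ i, ∫ x, |fderiv ℝ g x (b i)| ∂(stdGaussian E) ≤ J i)
    (hJL : ∀ i, J i ≤ Real.exp (-L)) :
    ∫ x, g x ^ 2 ∂(stdGaussian E) - (∫ x, g x ∂(stdGaussian E)) ^ 2
      ≤ √6 * (∑ i, J i) * (√(3 * Real.pi ^ 3 / L) / 2) := by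
  have hgm : Measurable g := hd.continuous.measurable
  have hJ0 : ∀ i, 0 ≤ J i := fun i => (integral_nonneg fun x => abs_nonneg _).trans (hJ i)
  have hS0 : 0 ≤ ∑ i, J i := Finset.sum_nonneg fun i _ => hJ0 i
  set φ : ℝ → ℝ := fun θ => ∫ p : E × E, g p.1 * g (Real.cos θ • p.1 + Real.sin θ • p.2)
        ∂((stdGaussian E).prod (stdGaussian E)) with hφ
  have hgg : ∀ x y, |g x * g y| ≤ 1 := fun x y => by
    rw [abs_mul]; exact mul_le_one₀ (hb _) (abs_nonneg _) (hb _)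
  have h0 : φ 0 = ∫ x, g x ^ 2 ∂(stdGaussian E) := by
    simp only [hφ, Real.cos_zero, Real.sin_zero, one_smul, zero_smul, add_zero]
    rw [integral_prod _ (integrable_prod_of_bounded (by fun_prop) fun p => hgg _ _)]
    simp [sq]
  have h1 : φ (Real.pi / 2) = (∫ x, g x ∂(stdGaussian E)) ^ 2 := by
    simp only [hφ, Real.cos_pi_div_two, Real.sin_pi_div_two, one_smul, zero_smul, zero_add]
    rw [integral_prod_mul, sq]
  have hder := hasDerivAt_integral_mul_rotation hd hb hL b
  -- The decay `exp (-(L * (1 - cos θ) / 6))` and `1 - cos θ ≥ 2 θ² / π²` give `exp (-B * θ ^ 2)`.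
  set B := L / (3 * Real.pi ^ 2) with hB
  have hB0 : 0 < B := by positivity
  have hle := intervalIntegral.sub_le_integral_of_hasDeriv_right_of_le (a := 0) (b := Real.pi / 2)
    (g := fun θ => -φ θ)
    (g' := fun θ => Real.sin θ * ∑ i, ∫ x, fderiv ℝ g x (b i) *
        mehler (Real.cos θ) (Real.sin θ) (fun y => fderiv ℝ g y (b i)) x ∂(stdGaussian E))
    (φ := fun θ => √6 * (∑ i, J i) * Real.exp (-B * θ ^ 2)) (by positivity)
    (fun θ _ => (hder θ).continuousAt.neg.continuousWithinAt)
    (fun θ _ => by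
      have := (hder θ).neg
      rw [neg_neg] at this
      exact this.hasDerivWithinAt)
    (Continuous.integrableOn_Icc (by fun_prop))
    (fun θ hθ => by
      have hs0 : 0 < Real.sin θ := Real.sin_pos_of_pos_of_lt_pi hθ.1 (by linarith [hθ.2, Real.pi_pos])
      have hc0 : 0 < Real.cos θ := Real.cos_pos_of_mem_Ioo ⟨by linarith [hθ.1, Real.pi_pos], hθ.2⟩
      have hcs := Real.cos_sq_add_sin_sq θ
      have hc1 : Real.cos θ < 1 := by nlinarith
      have hq0 : 0 < √(1 - Real.cos θ) := Real.sqrt_pos.2 (by linarith)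
      -- The factor `sin θ` absorbs the singularity `1 / √(1 - cos θ)` at `θ = 0`.
      have hsin : Real.sin θ ≤ √2 * √(1 - Real.cos θ) := by
        rw [← Real.sqrt_mul (by norm_num)]
        apply Real.le_sqrt_of_sq_le
        nlinarith
      have hcos : Real.cos θ ≤ 1 - 2 / Real.pi ^ 2 * θ ^ 2 := by
        apply Real.cos_le_one_sub_mul_cos_sq
        rw [abs_of_pos hθ.1]
        linarith [hθ.2, Real.pi_pos]
      have hexp : Real.exp (-(L * (1 - Real.cos θ) / 6)) ≤ Real.exp (-B * θ ^ 2) := by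
        apply Real.exp_le_exp.2
        have h2 : B * θ ^ 2 = L * (2 / Real.pi ^ 2 * θ ^ 2) / 6 := by
          rw [hB]; field_simp; ring
        have h3 : L * (2 / Real.pi ^ 2 * θ ^ 2) ≤ L * (1 - Real.cos θ) :=
          mul_le_mul_of_nonneg_left (by linarith) hL0.le
        linarith
      calc Real.sin θ * ∑ i, ∫ x, fderiv ℝ g x (b i) *
            mehler (Real.cos θ) (Real.sin θ) (fun y => fderiv ℝ g y (b i)) x ∂(stdGaussian E)
          ≤ Real.sin θ * ∑ i, √3 / √(1 - Real.cos θ) * (J i * Real.exp (-B * θ ^ 2)) := by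
            refine mul_le_mul_of_nonneg_left (Finset.sum_le_sum fun i _ => ?_) hs0.le
            refine (integral_fderiv_mul_mehler_le hd hb hL (b.norm_eq_one i) (hJ i) hL0.le (hJL i)
              hc0 hc1 hcs).trans ?_
            have := hJ0 i
            gcongr
        _ = (Real.sin θ / √(1 - Real.cos θ)) * (√3 * (∑ i, J i) * Real.exp (-B * θ ^ 2)) := by
            rw [← Finset.mul_sum, ← Finset.sum_mul]
            ring
        _ ≤ √2 * (√3 * (∑ i, J i) * Real.exp (-B * θ ^ 2)) := by
            refine mul_le_mul_of_nonneg_right ?_ (by positivity)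
            rwa [div_le_iff₀ hq0]
        _ = √6 * (∑ i, J i) * Real.exp (-B * θ ^ 2) := by
            have : √6 = √2 * √3 := by rw [← Real.sqrt_mul (by norm_num)]; norm_num
            rw [this]; ring)
  rw [intervalIntegral.integral_const_mul] at hle
  have hgauss : ∫ θ in (0 : ℝ)..(Real.pi / 2), Real.exp (-B * θ ^ 2)
      ≤ √(3 * Real.pi ^ 3 / L) / 2 := by
    have e1 : Real.pi / B = 3 * Real.pi ^ 3 / L := by rw [hB]; field_simp
    rw [← e1, ← integral_gaussian_Ioi, intervalIntegral.integral_of_le (by positivity)]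
    exact setIntegral_mono_set (integrable_exp_neg_mul_sq hB0).integrableOn
      (ae_of_all _ fun _ => (Real.exp_pos _).le) (Set.Ioc_subset_Ioi_self).eventuallyLE
  have := mul_le_mul_of_nonneg_left hgauss (show 0 ≤ √6 * (∑ i, J i) by positivity)
  rw [← h0, ← h1]
  linarith

end Interpolation

/-! ### Removal of the smoothing, and derivatives as slopes of translates. -/

section Limit

variable {E : Type*} [NormedAddCommGroup E] [InnerProductSpace ℝ E] [FiniteDimensional ℝ E]
  [MeasurableSpace E] [BorelSpace E]

lemma tendsto_mehler_apply {f : E → ℝ} (hf : Continuous f) {C : ℝ} (hb : ∀ x, |f x| ≤ C) (x : E) :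
    Tendsto (fun r : ℝ => mehler r √(1 - r ^ 2) f x) (𝓝[<] 1) (𝓝 (f x)) := by
  have h1 : f x = ∫ _ : E, f x ∂(stdGaussian E) := by simp
  rw [h1]
  refine tendsto_integral_filter_of_dominated_convergence (fun _ => C)
    (Eventually.of_forall fun r => (by fun_prop)) (Eventually.of_forall fun r =>
      ae_of_all _ fun y => hb _) (integrable_const _) (ae_of_all _ fun y => ?_)
  have h2 : Continuous fun r : ℝ => f (r • x + √(1 - r ^ 2) • y) := by fun_prop
  have h3 := (h2.tendsto 1).mono_left (nhdsWithin_le_nhds (s := Set.Iio 1))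
  simpa using h3

/-- Bounded continuous functions converge by domination; they are dense in `L¹`, on which the
operators are contractions. -/
lemma tendsto_integral_abs_mehler_sub {f : E → ℝ} (hf : Measurable f) {C : ℝ}
    (hb : ∀ x, |f x| ≤ C) :
    Tendsto (fun r : ℝ => ∫ x, |mehler r √(1 - r ^ 2) f x - f x| ∂(stdGaussian E))
      (𝓝[<] 1) (𝓝 0) := by
  have hfi : Integrable f (stdGaussian E) := integrable_stdGaussian_of_bounded hf hb
  rw [Metric.tendsto_nhds]
  intro ε hε
  obtain ⟨φ, hφ, hφi⟩ := hfi.exists_boundedContinuous_integral_sub_le (ε := ε / 4) (by positivity)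
  have hφb : ∀ x, |φ x| ≤ ‖φ‖ := fun x => φ.norm_coe_le_norm x
  have hφm : Measurable φ := φ.continuous.measurable
  have hφt : Tendsto (fun r : ℝ => ∫ x, |mehler r √(1 - r ^ 2) φ x - φ x| ∂(stdGaussian E))
      (𝓝[<] 1) (𝓝 0) := by
    have h0 : (0 : ℝ) = ∫ _ : E, (0 : ℝ) ∂(stdGaussian E) := by simp
    rw [h0]
    refine tendsto_integral_filter_of_dominated_convergence (fun _ => ‖φ‖ + ‖φ‖)
      (Eventually.of_forall fun r =>
        ((measurable_mehler _ _ hφm).sub hφm).abs.aestronglyMeasurable)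
      (Eventually.of_forall fun r => ae_of_all _ fun y => ?_) (integrable_const _)
      (ae_of_all _ fun y => ?_)
    · rw [Real.norm_eq_abs, abs_abs]
      exact (abs_sub _ _).trans (add_le_add (abs_mehler_le _ _ hφb y) (hφb y))
    · have := ((tendsto_mehler_apply φ.continuous hφb y).sub_const (φ y)).abs
      simpa using this
  have hlt : ∀ᶠ r in 𝓝[<] (1 : ℝ), ∫ x, |mehler r √(1 - r ^ 2) φ x - φ x| ∂(stdGaussian E) < ε / 4 :=
    hφt.eventually (gt_mem_nhds (by positivity))
  have hpos : ∀ᶠ r in 𝓝[<] (1 : ℝ), 0 < r :=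
    nhdsWithin_le_nhds (lt_mem_nhds zero_lt_one)
  filter_upwards [hlt, hpos, self_mem_nhdsWithin] with r hr hr0 hr1
  have hr1' : r < 1 := hr1
  have hrs : r ^ 2 + √(1 - r ^ 2) ^ 2 = 1 := by
    rw [Real.sq_sqrt (by nlinarith)]; ring
  rw [Real.dist_eq, sub_zero, abs_of_nonneg (integral_nonneg fun x => abs_nonneg _)]
  set s := √(1 - r ^ 2)
  have hdm : Measurable fun x => f x - φ x := hf.sub hφm
  have hdb : ∀ x, |f x - φ x| ≤ C + ‖φ‖ := fun x =>
    (abs_sub _ _).trans (add_le_add (hb x) (hφb x))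
  have hsub : ∀ x, mehler r s (fun x => f x - φ x) x = mehler r s f x - mehler r s φ x := fun x =>
    integral_sub (integrable_stdGaussian_of_bounded (by fun_prop) fun y => hb _)
      (integrable_stdGaussian_of_bounded (by fun_prop) fun y => hφb _)
  have i1 : Integrable (fun x => |mehler r s (fun x => f x - φ x) x|) (stdGaussian E) :=
    (integrable_stdGaussian_of_bounded (measurable_mehler r s hdm) (abs_mehler_le r s hdb)).abs
  have i2 : Integrable (fun x => |mehler r s φ x - φ x|) (stdGaussian E) :=
    ((integrable_stdGaussian_of_bounded (measurable_mehler r s hφm)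
      (abs_mehler_le r s hφb)).sub hφi).abs
  have i3 : Integrable (fun x => |f x - φ x|) (stdGaussian E) := (hfi.sub hφi).abs
  have h1 := integral_abs_mehler_le hrs hdm hdb
  have hφ' : ∫ x, |f x - φ x| ∂(stdGaussian E) ≤ ε / 4 := hφ
  calc ∫ x, |mehler r s f x - f x| ∂(stdGaussian E)
      ≤ ∫ x, (|mehler r s (fun x => f x - φ x) x| + |mehler r s φ x - φ x| + |f x - φ x|)
          ∂(stdGaussian E) := by
        refine integral_mono_of_nonneg (ae_of_all _ fun x => abs_nonneg _)
          ((i1.add i2).add i3) (ae_of_all _ fun x => ?_)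
        simp only [hsub]
        have e : mehler r s f x - f x = (mehler r s f x - mehler r s φ x) +
          (mehler r s φ x - φ x) - (f x - φ x) := by ring
        rw [e]
        exact (abs_sub _ _).trans (add_le_add_left (abs_add_le _ _) _)
    _ = ∫ x, |mehler r s (fun x => f x - φ x) x| ∂(stdGaussian E)
        + ∫ x, |mehler r s φ x - φ x| ∂(stdGaussian E)
        + ∫ x, |f x - φ x| ∂(stdGaussian E) := by
        have i12 : Integrable (fun x => |mehler r s (fun x => f x - φ x) x|
            + |mehler r s φ x - φ x|) (stdGaussian E) := i1.add i2
        rw [integral_add i12 i3, integral_add i1 i2]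
    _ < ε := by linarith

lemma tendsto_integral_mehler_sq {f : E → ℝ} (hf : Measurable f) {C : ℝ} (hb : ∀ x, |f x| ≤ C) :
    Tendsto (fun r : ℝ => ∫ x, mehler r √(1 - r ^ 2) f x ^ 2 ∂(stdGaussian E)) (𝓝[<] 1)
      (𝓝 (∫ x, f x ^ 2 ∂(stdGaussian E))) := by
  have h := (tendsto_integral_abs_mehler_sub hf hb).const_mul (C + C)
  rw [mul_zero] at h
  rw [tendsto_iff_norm_sub_tendsto_zero]
  refine squeeze_zero (fun _ => norm_nonneg _) (fun r => ?_) h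
  have hM := measurable_mehler r √(1 - r ^ 2) hf
  have hMb := abs_mehler_le r √(1 - r ^ 2) hb
  set M := mehler r √(1 - r ^ 2) f
  have hsq : ∀ u : E → ℝ, Measurable u → (∀ x, |u x| ≤ C) →
      Integrable (fun x => u x ^ 2) (stdGaussian E) := fun u hu hub =>
    integrable_stdGaussian_of_bounded (by fun_prop) (C := C ^ 2) fun x => by
      rw [abs_pow]; exact pow_le_pow_left₀ (abs_nonneg _) (hub x) 2
  rw [← integral_sub (hsq M hM hMb) (hsq f hf hb), ← integral_const_mul]
  refine (norm_integral_le_integral_norm _).trans (integral_mono_of_nonneg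
    (ae_of_all _ fun x => norm_nonneg _) ?_ (ae_of_all _ fun x => ?_))
  · exact ((integrable_stdGaussian_of_bounded hM hMb).sub
      (integrable_stdGaussian_of_bounded hf hb)).abs.const_mul _
  · simp only
    rw [Real.norm_eq_abs, sq_sub_sq, abs_mul]
    exact mul_le_mul_of_nonneg_right ((abs_add_le _ _).trans (add_le_add (hMb x) (hb x)))
      (abs_nonneg _)

/-- The mean of a directional derivative of `mehler r s f` is the derivative of the mean of the
translates of `f`. -/
lemma tendsto_slope_integral_translate {r s : ℝ} (h : r ^ 2 + s ^ 2 = 1) (hs : s ≠ 0) {f : E → ℝ}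
    (hf : Measurable f) {C : ℝ} (hb : ∀ x, |f x| ≤ C) (v : E) :
    Tendsto (fun t : ℝ => (∫ x, f (x + (r * t) • v) ∂(stdGaussian E) - ∫ x, f x ∂(stdGaussian E)) / t)
      (𝓝[>] 0) (𝓝 (∫ x, fderiv ℝ (mehler r s f) x v ∂(stdGaussian E))) := by
  have hd := differentiable_mehler (r := r) hs hf hb
  have hL := norm_fderiv_mehler_le (r := r) hs hf hb
  have hgm := measurable_mehler r s hf
  have hder := (hasDerivAt_integral_of_dominated_loc_of_deriv_le (μ := stdGaussian E)
    (x₀ := (0 : ℝ)) (F := fun t x => mehler r s f (x + t • v))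
    (F' := fun t x => fderiv ℝ (mehler r s f) (x + t • v) v)
    (bound := fun _ => |r / s| * C * ‖v‖) univ_mem
    (Eventually.of_forall fun t => by
      have : Measurable fun x => mehler r s f (x + t • v) := by fun_prop
      exact this.aestronglyMeasurable)
    (integrable_stdGaussian_of_bounded (by fun_prop) fun x => abs_mehler_le r s hb _)
    (by
      have : Measurable fun x => fderiv ℝ (mehler r s f) (x + (0 : ℝ) • v) v :=
        (measurable_fderiv_apply_const ℝ (mehler r s f) v).comp (by fun_prop)
      exact this.aestronglyMeasurable)
    (ae_of_all _ fun x t _ => abs_fderiv_apply_le hL _ _) (integrable_const _)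
    (ae_of_all _ fun x t _ => by
      have hline : HasDerivAt (fun t : ℝ => x + t • v) v t := by
        simpa using ((hasDerivAt_id t).smul_const v).const_add x
      exact (hd _).hasFDerivAt.comp_hasDerivAt t hline)).2
  -- Translating the average by `t • v` averages the translate by `(r * t) • v`, and averaging
  -- preserves the mean.
  have hint : ∀ t : ℝ, ∫ x, mehler r s f (x + t • v) ∂(stdGaussian E)
      = ∫ x, f (x + (r * t) • v) ∂(stdGaussian E) := by
    intro t
    rw [← integral_mehler h (f := fun x => f (x + (r * t) • v)) (by fun_prop) fun x => hb _]
    congr 1 with x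
    unfold mehler
    congr 1 with y
    congr 1
    module
  simp only [zero_smul, add_zero, hint] at hder
  have := hder.tendsto_slope_zero_right
  refine this.congr fun t => ?_
  simp only [zero_add, mul_zero, zero_smul, add_zero, smul_eq_mul]
  ring

lemma fderiv_mehler_nonneg_of_monotone_along {r s : ℝ} (hr : 0 ≤ r) (hs : s ≠ 0) {f : E → ℝ}
    (hf : Measurable f) {C : ℝ} (hb : ∀ x, |f x| ≤ C) {v : E}
    (hv : ∀ x, ∀ t : ℝ, 0 ≤ t → f x ≤ f (x + t • v)) (x : E) :
    0 ≤ fderiv ℝ (mehler r s f) x v := by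
  have hline : HasDerivAt (fun t : ℝ => x + t • v) v 0 := by
    simpa using ((hasDerivAt_id (0 : ℝ)).smul_const v).const_add x
  have hd : HasFDerivAt (mehler r s f) (fderiv ℝ (mehler r s f) x) (x + (0 : ℝ) • v) := by
    rw [zero_smul, add_zero]
    exact (differentiable_mehler hs hf hb x).hasFDerivAt
  have h1 := (hd.comp_hasDerivAt (0 : ℝ) hline).tendsto_slope_zero_right
  refine ge_of_tendsto h1 ?_
  filter_upwards [self_mem_nhdsWithin] with t ht
  have ht0 : (0 : ℝ) < t := ht
  rw [smul_eq_mul]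
  refine mul_nonneg (by positivity) (sub_nonneg.2 ?_)
  simp only [Function.comp_apply, zero_add, zero_smul, add_zero]
  refine integral_mono (integrable_stdGaussian_of_bounded (by fun_prop) fun y => hb _)
    (integrable_stdGaussian_of_bounded (by fun_prop) fun y => hb _) fun y => ?_
  have e : r • (x + t • v) + s • y = (r • x + s • y) + (r * t) • v := by module
  simp only [e]
  exact hv _ _ (by positivity)

end Limit

/-! ### The matrix `R`: row sums and change of variables. -/

section Sets

variable {n : ℕ}

/-- Test the operator norm on the sign vector of the row. -/
lemma sum_abs_row_le_infOpNorm (R : Matrix (Fin n) (Fin n) ℝ) (i : Fin n) :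
    ∑ j, |R i j| ≤ infOpNorm R := by
  set x : Fin n → ℝ := fun j => (SignType.sign (R i j) : ℝ) with hx
  have hx1 : ‖x‖ ≤ 1 := by
    refine (pi_norm_le_iff_of_nonneg zero_le_one).2 fun j => ?_
    rcases lt_trichotomy (R i j) 0 with h | h | h <;> simp [hx, h]
  have h1 := (LinearMap.toContinuousLinearMap
    (Matrix.mulVecLin R : (Fin n → ℝ) →ₗ[ℝ] (Fin n → ℝ))).le_opNorm x
  have h2 : ∑ j, |R i j| = (Matrix.mulVec R x) i := by
    simp [Matrix.mulVec, dotProduct, hx, self_mul_sign]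
  calc ∑ j, |R i j| ≤ |(Matrix.mulVec R x) i| := by rw [h2]; exact le_abs_self _
    _ ≤ ‖Matrix.mulVec R x‖ := norm_le_pi_norm (Matrix.mulVec R x) i
    _ ≤ infOpNorm R * ‖x‖ := h1
    _ ≤ infOpNorm R := mul_le_of_le_one_right (norm_nonneg _) hx1

/-- The characteristic function of the image sees `R` only through `‖R t‖² = ⟨t, S t⟩`, so any
symmetric root will do, positive or not. -/
lemma multivariateGaussian_zero_eq_map {S R : Matrix (Fin n) (Fin n) ℝ} (hS : S.PosSemidef)
    (hR : R.IsSymm) (hRS : R * R = S) :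
    multivariateGaussian 0 S =
      (stdGaussian (EuclideanSpace ℝ (Fin n))).map (Matrix.toEuclideanCLM (𝕜 := ℝ) R) := by
  have : IsProbabilityMeasure
      ((stdGaussian (EuclideanSpace ℝ (Fin n))).map (Matrix.toEuclideanCLM (𝕜 := ℝ) R)) :=
    Measure.isProbabilityMeasure_map (by fun_prop)
  apply Measure.ext_of_charFun
  ext t
  have hinner : ∀ x, inner ℝ (Matrix.toEuclideanCLM (𝕜 := ℝ) R x) t
      = inner ℝ x (Matrix.toEuclideanCLM (𝕜 := ℝ) R t) := by
    intro x
    rw [real_inner_comm, Matrix.inner_toEuclideanCLM, Matrix.inner_toEuclideanCLM,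
      Matrix.dotProduct_mulVec, ← Matrix.mulVec_transpose, hR.eq, dotProduct_comm]
  have hmap : charFun ((stdGaussian (EuclideanSpace ℝ (Fin n))).map
      (Matrix.toEuclideanCLM (𝕜 := ℝ) R)) t =
      charFun (stdGaussian (EuclideanSpace ℝ (Fin n))) (Matrix.toEuclideanCLM (𝕜 := ℝ) R t) := by
    rw [charFun_apply, charFun_apply, integral_map (by fun_prop) (by fun_prop)]
    simp_rw [hinner]
  have hnorm : ‖Matrix.toEuclideanCLM (𝕜 := ℝ) R t‖ ^ 2 = t ⬝ᵥ S.mulVec t := by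
    rw [← real_inner_self_eq_norm_sq, ← hinner, real_inner_comm, Matrix.inner_toEuclideanCLM,
      Matrix.ofLp_toEuclideanCLM, Matrix.mulVec_mulVec, hRS]
  rw [charFun_multivariateGaussian hS, hmap, charFun_stdGaussian, inner_zero_right,
    ← Complex.ofReal_pow, hnorm]
  congr 1
  push_cast
  ring

end Sets

/-! ### Influences as bounds for `L¹` norms of derivatives. -/

section Influence

variable {n : ℕ}

lemma subset_thicken_of_add_mem {A : Set (EuclideanSpace ℝ (Fin n))} {v : EuclideanSpace ℝ (Fin n)}
    {t u : ℝ} (h : |u| ≤ t) : {x | x + u • v ∈ A} ⊆ thicken A t v := by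
  intro x hx
  refine Set.mem_add.2 ⟨x + u • v, hx, -u • v, ⟨-u, ?_, rfl⟩, by module⟩
  rw [abs_le] at h
  exact ⟨by linarith, by linarith⟩

lemma exists_sign_of_isMonotonic {A : Set (EuclideanSpace ℝ (Fin n))} (hA : IsMonotonic A) :
    ∃ ε : ℝ, |ε| = 1 ∧ ∀ x ∈ A, ∀ i : Fin n, ∀ t : ℝ, 0 ≤ t →
      x + (t * ε) • EuclideanSpace.single i (1 : ℝ) ∈ A := by
  rcases hA with hA | hA
  · refine ⟨1, by simp, fun x hx i t ht => hA x hx _ fun j => ?_⟩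
    by_cases hij : j = i <;> simp [hij, ht]
  · refine ⟨-1, by simp, fun x hx i t ht => hA x hx _ fun j => ?_⟩
    by_cases hij : j = i <;> simp [hij, ht]

variable {S R : Matrix (Fin n) (Fin n) ℝ}

/-- The `L¹` norm of the derivative of a Gaussian average of `1_A`, along the preimage of a
basis vector, is at most the corresponding influence of `A`. -/
lemma ofReal_integral_abs_fderiv_le_coordInfluence
    (hμ : multivariateGaussian 0 S =
      (stdGaussian (EuclideanSpace ℝ (Fin n))).map (Matrix.toEuclideanCLM (𝕜 := ℝ) R))
    {A : Set (EuclideanSpace ℝ (Fin n))} (hA : MeasurableSet A) {ε : ℝ} (hε : |ε| = 1)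
    (hmono : ∀ x ∈ A, ∀ i : Fin n, ∀ t : ℝ, 0 ≤ t →
      x + (t * ε) • EuclideanSpace.single i (1 : ℝ) ∈ A)
    {r s : ℝ} (hr0 : 0 ≤ r) (hr1 : r ≤ 1) (hs : s ≠ 0) (hrs : r ^ 2 + s ^ 2 = 1)
    (i : Fin n) {v : EuclideanSpace ℝ (Fin n)}
    (hv : Matrix.toEuclideanCLM (𝕜 := ℝ) R v = EuclideanSpace.single i (1 : ℝ)) :
    ENNReal.ofReal (∫ x, |fderiv ℝ (mehler r s
        ((Matrix.toEuclideanCLM (𝕜 := ℝ) R ⁻¹' A).indicator 1)) x v|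
          ∂(stdGaussian (EuclideanSpace ℝ (Fin n))))
      ≤ coordInfluence (multivariateGaussian 0 S) i A := by
  set T := Matrix.toEuclideanCLM (𝕜 := ℝ) R with hT
  set f : EuclideanSpace ℝ (Fin n) → ℝ := (T ⁻¹' A).indicator 1 with hf
  have hTA : MeasurableSet (T ⁻¹' A) := T.continuous.measurable hA
  have hfm : Measurable f := measurable_one.indicator hTA
  have hfb : ∀ x, |f x| ≤ 1 := fun x => by
    by_cases hx : x ∈ T ⁻¹' A <;> simp [hf, hx]
  have hprob : IsProbabilityMeasure (multivariateGaussian 0 S) := inferInstance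
  have hfmono : ∀ x, ∀ t : ℝ, 0 ≤ t → f x ≤ f (x + t • ε • v) := by
    intro x t ht
    by_cases hx : x ∈ T ⁻¹' A
    · have : x + t • ε • v ∈ T ⁻¹' A := by
        simp only [Set.mem_preimage, map_add, map_smul, hv, smul_smul]
        exact hmono _ hx i t ht
      simp [hf, hx, this]
    · simp only [hf, Set.indicator_of_notMem hx]
      exact Set.indicator_nonneg (fun _ _ => zero_le_one) _
  have hnn := fderiv_mehler_nonneg_of_monotone_along hr0 hs hfm hfb hfmono
  -- The only use of monotonicity: the derivative has constant sign, so its `L¹` norm is a plain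
  -- mean, which is a limit of slopes.
  have habs : ∀ x, |fderiv ℝ (mehler r s f) x v| = fderiv ℝ (mehler r s f) x (ε • v) := by
    intro x
    rw [← abs_of_nonneg (hnn x), map_smul, smul_eq_mul, abs_mul, hε, one_mul]
  simp_rw [habs]
  have hlim := (ENNReal.continuous_ofReal.tendsto _).comp
    (tendsto_slope_integral_translate hrs hs hfm hfb (ε • v))
  rw [← hlim.liminf_eq]
  refine liminf_le_liminf ?_
  filter_upwards [self_mem_nhdsWithin] with t ht
  have ht0 : (0 : ℝ) < t := ht
  simp only [Function.comp_apply]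
  rw [ENNReal.ofReal_div_of_pos ht0]
  gcongr
  have htr : ∀ u : ℝ, ∫ x, f (x + u • v) ∂(stdGaussian (EuclideanSpace ℝ (Fin n)))
      = (multivariateGaussian 0 S).real {x | x + u • EuclideanSpace.single i (1 : ℝ) ∈ A} := by
    intro u
    have hset : MeasurableSet {x : EuclideanSpace ℝ (Fin n) |
        x + u • EuclideanSpace.single i (1 : ℝ) ∈ A} := by
      have : Measurable fun x : EuclideanSpace ℝ (Fin n) =>
        x + u • EuclideanSpace.single i (1 : ℝ) := by fun_prop
      exact this hA
    rw [hμ, map_measureReal_apply T.continuous.measurable hset,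
      ← integral_indicator_one (T.continuous.measurable hset)]
    congr 1 with x
    have e : (x + u • v ∈ T ⁻¹' A) ↔
        (x ∈ T ⁻¹' {x | x + u • EuclideanSpace.single i (1 : ℝ) ∈ A}) := by
      simp only [Set.mem_preimage, Set.mem_ofPred_eq, map_add, map_smul, hv]
    by_cases hx : x + u • v ∈ T ⁻¹' A
    · rw [hf, Set.indicator_of_mem hx, Set.indicator_of_mem (e.1 hx)]; rfl
    · rw [hf, Set.indicator_of_notMem hx, Set.indicator_of_notMem (fun h => hx (e.2 h))]
  have h0 := htr 0
  simp only [zero_smul, add_zero, Set.ofPred_mem_eq] at h0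
  rw [smul_smul, htr, h0, ENNReal.ofReal_sub _ measureReal_nonneg, ofReal_measureReal,
    ofReal_measureReal]
  -- The translation length is `r * t ≤ t`, so the translated set stays inside the enlargement of
  -- size `t`.
  refine tsub_le_tsub_right (measure_mono (subset_thicken_of_add_mem ?_)) _
  rw [abs_mul, hε, mul_one, abs_of_nonneg (by positivity)]
  exact mul_le_of_le_one_left ht0.le hr1

/-- The real form of the inequality, when all influences are finite. -/
lemma measureReal_mul_one_sub_le (hS : S.PosDef) (hR : R.IsSymm) (hRS : R * R = S)
    {A : Set (EuclideanSpace ℝ (Fin n))} (hA : MeasurableSet A) (hmono : IsMonotonic A)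
    (hfin : ∀ i, coordInfluence (multivariateGaussian 0 S) i A ≠ ⊤)
    (hM : 0 < infOpNorm R) {L : ℝ} (hL : 0 < L)
    (hI : ∀ i, infOpNorm R * (coordInfluence (multivariateGaussian 0 S) i A).toReal
      ≤ Real.exp (-L)) :
    (multivariateGaussian 0 S).real A * (1 - (multivariateGaussian 0 S).real A)
      ≤ √6 * (infOpNorm R * ∑ i, (coordInfluence (multivariateGaussian 0 S) i A).toReal) *
        (√(3 * Real.pi ^ 3 / L) / 2) := by
  have hμ := multivariateGaussian_zero_eq_map hS.posSemidef hR hRS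
  obtain ⟨ε, hε, hεA⟩ := exists_sign_of_isMonotonic hmono
  set I : Fin n → ℝ := fun i => (coordInfluence (multivariateGaussian 0 S) i A).toReal with hIdef
  have hI0 : ∀ i, 0 ≤ I i := fun i => ENNReal.toReal_nonneg
  set T := Matrix.toEuclideanCLM (𝕜 := ℝ) R with hT
  have hunit : IsUnit R.det := by
    have h1 : R.det * R.det = S.det := by rw [← Matrix.det_mul, hRS]
    have h2 : S.det ≠ 0 := hS.det_pos.ne'
    exact isUnit_iff_ne_zero.2 fun h => h2 (by rw [← h1, h, mul_zero])
  set v : Fin n → EuclideanSpace ℝ (Fin n) := fun i =>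
    Matrix.toEuclideanCLM (𝕜 := ℝ) R⁻¹ (EuclideanSpace.single i (1 : ℝ)) with hv
  have hTinv : ∀ x, T (Matrix.toEuclideanCLM (𝕜 := ℝ) R⁻¹ x) = x := fun x => by
    rw [hT, ← mul_apply_eq_comp, ← map_mul, Matrix.mul_nonsing_inv _ hunit, map_one]
    rfl
  have hinvT : ∀ x, Matrix.toEuclideanCLM (𝕜 := ℝ) R⁻¹ (T x) = x := fun x => by
    rw [hT, ← mul_apply_eq_comp, ← map_mul, Matrix.nonsing_inv_mul _ hunit, map_one]
    rfl
  have hTv : ∀ i, T (v i) = EuclideanSpace.single i (1 : ℝ) := fun i => hTinv _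
  let b := EuclideanSpace.basisFun (Fin n) ℝ
  -- Standard partial derivatives are thus combinations of derivatives along the `v i`, the
  -- directions that `T` sends to coordinate vectors.
  have hbv : ∀ j, b j = ∑ i, R i j • v i := by
    intro j
    have h1 : T (b j) = ∑ i, R i j • EuclideanSpace.single i (1 : ℝ) := by
      ext k
      simp [b, hT, Matrix.ofLp_toEuclideanCLM, Pi.single_apply]
    rw [← hinvT (b j), h1]
    simp [hv]
  set f : EuclideanSpace ℝ (Fin n) → ℝ := (T ⁻¹' A).indicator 1 with hf
  have hTA : MeasurableSet (T ⁻¹' A) := T.continuous.measurable hA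
  have hfm : Measurable f := measurable_one.indicator hTA
  have hfb : ∀ x, |f x| ≤ 1 := fun x => by
    by_cases hx : x ∈ T ⁻¹' A <;> simp [hf, hx]
  have hfint : ∫ x, f x ∂(stdGaussian (EuclideanSpace ℝ (Fin n)))
      = (multivariateGaussian 0 S).real A := by
    rw [hf, integral_indicator_one hTA, hμ, map_measureReal_apply T.continuous.measurable hA]
  have hfsq : ∀ x, f x ^ 2 = f x := fun x => by
    by_cases hx : x ∈ T ⁻¹' A <;> simp [hf, hx]
  -- Symmetry of `R` turns the row bound into a column bound; columns control each `J j`, rows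
  -- control their sum.
  have hcol : ∀ j, ∑ i, |R i j| ≤ infOpNorm R := fun j => by
    have := sum_abs_row_le_infOpNorm R j
    simpa only [fun i => hR.apply i j] using this
  set J : Fin n → ℝ := fun j => ∑ i, |R i j| * I i with hJ
  have hJL : ∀ j, J j ≤ Real.exp (-L) := fun j => by
    calc J j ≤ ∑ i, |R i j| * (Real.exp (-L) / infOpNorm R) := by
          refine Finset.sum_le_sum fun i _ => mul_le_mul_of_nonneg_left ?_ (abs_nonneg _)
          rw [le_div_iff₀ hM, mul_comm]
          exact hI i
      _ = (∑ i, |R i j|) * (Real.exp (-L) / infOpNorm R) := by rw [Finset.sum_mul]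
      _ ≤ infOpNorm R * (Real.exp (-L) / infOpNorm R) :=
          mul_le_mul_of_nonneg_right (hcol j) (by positivity)
      _ = Real.exp (-L) := by field_simp
  have hJsum : ∑ j, J j ≤ infOpNorm R * ∑ i, I i := by
    rw [hJ, Finset.sum_comm, Finset.mul_sum]
    refine Finset.sum_le_sum fun i _ => ?_
    rw [← Finset.sum_mul]
    exact mul_le_mul_of_nonneg_right (sum_abs_row_le_infOpNorm R i) (hI0 i)
  have hlim := (tendsto_integral_mehler_sq hfm hfb).sub_const
    ((multivariateGaussian 0 S).real A ^ 2)
  simp_rw [hfsq, hfint] at hlim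
  have hV : (multivariateGaussian 0 S).real A * (1 - (multivariateGaussian 0 S).real A)
      = (multivariateGaussian 0 S).real A - (multivariateGaussian 0 S).real A ^ 2 := by ring
  rw [hV]
  refine le_of_tendsto hlim ?_
  have hpos : ∀ᶠ r in 𝓝[<] (1 : ℝ), 0 < r := nhdsWithin_le_nhds (lt_mem_nhds zero_lt_one)
  filter_upwards [hpos, self_mem_nhdsWithin] with r hr0 hr1
  have hr1' : r < 1 := hr1
  have hs : √(1 - r ^ 2) ≠ 0 := (Real.sqrt_pos.2 (by nlinarith)).ne'
  have hrs : r ^ 2 + √(1 - r ^ 2) ^ 2 = 1 := by rw [Real.sq_sqrt (by nlinarith)]; ring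
  set s := √(1 - r ^ 2)
  have hd := differentiable_mehler (r := r) hs hfm hfb
  have hD := norm_fderiv_mehler_le (r := r) hs hfm hfb
  have hint : ∀ w, Integrable (fun x => |fderiv ℝ (mehler r s f) x w|)
      (stdGaussian (EuclideanSpace ℝ (Fin n))) := fun w =>
    (integrable_stdGaussian_of_bounded (measurable_fderiv_apply_const ℝ _ w)
      (fun x => abs_fderiv_apply_le hD x w)).abs
  have hIi : ∀ i, ∫ x, |fderiv ℝ (mehler r s f) x (v i)|
      ∂(stdGaussian (EuclideanSpace ℝ (Fin n))) ≤ I i := fun i =>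
    (ENNReal.ofReal_le_iff_le_toReal (hfin i)).1
      (ofReal_integral_abs_fderiv_le_coordInfluence hμ hA hε hεA hr0.le hr1'.le hs hrs i (hTv i))
  have hJi : ∀ j, ∫ x, |fderiv ℝ (mehler r s f) x (b j)|
      ∂(stdGaussian (EuclideanSpace ℝ (Fin n))) ≤ J j := by
    intro j
    calc ∫ x, |fderiv ℝ (mehler r s f) x (b j)| ∂(stdGaussian (EuclideanSpace ℝ (Fin n)))
        ≤ ∫ x, ∑ i, |R i j| * |fderiv ℝ (mehler r s f) x (v i)|
            ∂(stdGaussian (EuclideanSpace ℝ (Fin n))) := by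
          refine integral_mono (hint _)
            (integrable_finsetSum _ fun i _ => (hint (v i)).const_mul _) fun x => ?_
          simp only
          rw [hbv j, map_sum]
          refine (Finset.abs_sum_le_sum_abs _ _).trans (Finset.sum_le_sum fun i _ => ?_)
          rw [map_smul, smul_eq_mul, abs_mul]
      _ = ∑ i, |R i j| * ∫ x, |fderiv ℝ (mehler r s f) x (v i)|
            ∂(stdGaussian (EuclideanSpace ℝ (Fin n))) := by
          rw [integral_finsetSum _ fun i _ => (hint (v i)).const_mul _]
          simp_rw [integral_const_mul]
      _ ≤ J j := Finset.sum_le_sum fun i _ => mul_le_mul_of_nonneg_left (hIi i) (abs_nonneg _)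
  have key := variance_le_sum_of_integral_abs_fderiv_le hd (abs_mehler_le r s hfb) hD b hL hJi hJL
  rw [integral_mehler hrs hfm hfb, hfint] at key
  refine key.trans ?_
  gcongr

end Influence

/-! ### Truncated logarithm and assembly in `[0, ∞]`. -/

lemma logPlus_one_div_of_one_le {x : ℝ≥0∞} (hx : 1 ≤ x) : logPlus (1 / x) = 0 := by
  have : ENNReal.log (1 / x) ≤ 0 := by
    rw [← ENNReal.log_one]
    apply ENNReal.log_monotone
    rwa [one_div, ENNReal.inv_le_one]
  rw [logPlus, max_eq_right this, EReal.toENNReal_zero]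

lemma logPlus_one_div_ofReal {x : ℝ} (hx0 : 0 < x) (hx1 : x ≤ 1) :
    logPlus (1 / ENNReal.ofReal x) = ENNReal.ofReal (-Real.log x) := by
  have h1 : 1 / ENNReal.ofReal x = ENNReal.ofReal x⁻¹ := by
    rw [one_div, ENNReal.ofReal_inv_of_pos hx0]
  have h2 : 0 ≤ -Real.log x := neg_nonneg.2 (Real.log_nonpos hx0.le hx1)
  rw [h1, logPlus, ENNReal.log_ofReal_of_pos (by positivity), Real.log_inv,
    max_eq_left (by exact_mod_cast h2)]
  exact EReal.toENNReal_of_ne_top (EReal.coe_ne_top _)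

end GaussianKKL

theorem theorem2p10 :
    ∃ c : ℝ, 0 < c ∧
      ∀ (n : ℕ), 0 < n →
      ∀ (S : Matrix (Fin n) (Fin n) ℝ), S.PosDef →
      ∀ (R : Matrix (Fin n) (Fin n) ℝ), R.IsSymm → R * R = S →
      ∀ (A : Set (EuclideanSpace ℝ (Fin n))), MeasurableSet A → GaussianKKL.IsMonotonic A →
        ENNReal.ofReal c * (ENNReal.ofReal (GaussianKKL.infOpNorm R))⁻¹ *
            multivariateGaussian 0 S A * (1 - multivariateGaussian 0 S A) *
            (GaussianKKL.logPlus
              (1 / (ENNReal.ofReal (GaussianKKL.infOpNorm R) *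
                ⨆ i : Fin n, GaussianKKL.coordInfluence (multivariateGaussian 0 S) i A)))
              ^ (1 / 2 : ℝ)
          ≤ ∑ i : Fin n, GaussianKKL.coordInfluence (multivariateGaussian 0 S) i A := by
  -- The inverse of the constant `√6 * √(3 π³) / 2` in `measureReal_mul_one_sub_le`.
  refine ⟨2 / (√6 * √(3 * Real.pi ^ 3)), by positivity, ?_⟩
  intro n hn S hS R hR hRS A hA hmono
  set c : ℝ := 2 / (√6 * √(3 * Real.pi ^ 3)) with hc
  set μ := multivariateGaussian 0 S with hμ
  set I : Fin n → ℝ≥0∞ := fun i => GaussianKKL.coordInfluence μ i A with hI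
  by_cases htop : ∃ i, I i = ⊤
  · have : ∑ i, I i = ⊤ := by
      obtain ⟨i, hi⟩ := htop
      exact ENNReal.sum_eq_top.2 ⟨i, Finset.mem_univ i, hi⟩
    exact le_top.trans_eq this.symm
  push Not at htop
  -- As `n > 0`, a vanishing `R` would contradict the positive diagonal of `S`.
  have hM : 0 < GaussianKKL.infOpNorm R := by
    refine (norm_nonneg _).lt_of_ne' fun h0 => ?_
    have hrow : ∀ i j, R i j = 0 := fun i j => abs_eq_zero.1 (le_antisymm
      (((Finset.single_le_sum (f := fun j => |R i j|) (fun _ _ => abs_nonneg _)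
        (Finset.mem_univ j)).trans (GaussianKKL.sum_abs_row_le_infOpNorm R i)).trans_eq h0) (abs_nonneg _))
    have hR0 : R = 0 := by ext i j; exact hrow i j
    have := hS.diag_pos (i := ⟨0, hn⟩)
    rw [← hRS, hR0] at this
    simp at this
  have hprob : IsProbabilityMeasure μ := inferInstanceAs (IsProbabilityMeasure (multivariateGaussian 0 S))
  set M := GaussianKKL.infOpNorm R with hMdef
  set K := ENNReal.ofReal M * ⨆ i, I i with hK
  have hIK : ∀ i, ENNReal.ofReal M * I i ≤ K := fun i => mul_le_mul_right (le_iSup I i) _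
  rcases le_or_gt 1 K with h1K | hK1
  · rw [GaussianKKL.logPlus_one_div_of_one_le h1K, ENNReal.zero_rpow_of_pos (by norm_num), mul_zero]
    exact zero_le
  have hKtop : K ≠ ⊤ := (hK1.trans ENNReal.one_lt_top).ne
  have hIreal : ∀ i, M * (I i).toReal ≤ K.toReal := fun i => by
    have := ENNReal.toReal_mono hKtop (hIK i)
    rwa [ENNReal.toReal_mul, ENNReal.toReal_ofReal hM.le] at this
  have hmain := fun (L : ℝ) (hL : 0 < L) (hKL : K.toReal ≤ Real.exp (-L)) =>
    GaussianKKL.measureReal_mul_one_sub_le hS hR hRS hA hmono htop hM hL fun i => (hIreal i).trans hKL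
  have hμA : μ A = ENNReal.ofReal (μ.real A) := (ofReal_measureReal).symm
  have hμA' : 1 - μ A = ENNReal.ofReal (1 - μ.real A) := by
    rw [ENNReal.ofReal_sub _ measureReal_nonneg, ENNReal.ofReal_one, ofReal_measureReal]
  have hp1 : 0 ≤ 1 - μ.real A := sub_nonneg.2 measureReal_le_one
  have hV0 : 0 ≤ μ.real A * (1 - μ.real A) := mul_nonneg measureReal_nonneg hp1
  rcases eq_or_ne K 0 with hK0 | hK0
  · have hI0 : ∀ i, (I i).toReal = 0 := fun i => by
      have := hIreal i
      rw [hK0, ENNReal.toReal_zero] at this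
      exact le_antisymm (by nlinarith) ENNReal.toReal_nonneg
    -- When all influences vanish any `L > 0` is admissible, and the bound forces `μ A * (1 - μ A) =
    -- 0`; the infinite logarithm is then killed by `0 * ∞ = 0`.
    have hle := hmain 1 one_pos (by rw [hK0]; simpa using (Real.exp_pos _).le)
    have hsum : ∑ i, (GaussianKKL.coordInfluence μ i A).toReal = 0 := Finset.sum_eq_zero fun i _ => hI0 i
    rw [hsum, mul_zero, mul_zero, zero_mul] at hle
    have hV : μ A * (1 - μ A) = 0 := by
      rw [hμA', hμA, ← ENNReal.ofReal_mul measureReal_nonneg, le_antisymm hle hV0,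
        ENNReal.ofReal_zero]
    rw [mul_assoc (_ * _) (μ A), hV, mul_zero, zero_mul]
    exact zero_le
  set k := K.toReal with hk
  have hk0 : 0 < k := ENNReal.toReal_pos hK0 hKtop
  have hk1 : k < 1 := by
    have := (ENNReal.toReal_lt_toReal hKtop ENNReal.one_ne_top).2 hK1
    simpa using this
  have hL : 0 < -Real.log k := neg_pos.2 (Real.log_neg hk0 hk1)
  have hle := hmain _ hL (by rw [neg_neg, Real.exp_log hk0])
  set L := -Real.log k with hLdef
  have hlog : GaussianKKL.logPlus (1 / K) = ENNReal.ofReal L := by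
    rw [← ENNReal.ofReal_toReal hKtop]
    exact GaussianKKL.logPlus_one_div_ofReal hk0 hk1.le
  have hsum : ∑ i, I i = ENNReal.ofReal (∑ i, (I i).toReal) := by
    rw [ENNReal.ofReal_sum_of_nonneg fun i _ => ENNReal.toReal_nonneg]
    exact Finset.sum_congr rfl fun i _ => (ENNReal.ofReal_toReal (htop i)).symm
  rw [hlog, hsum, hμA', hμA, ← ENNReal.ofReal_inv_of_pos hM,
    ENNReal.ofReal_rpow_of_nonneg hL.le (by norm_num), ← Real.sqrt_eq_rpow,
    ← ENNReal.ofReal_mul (by positivity), ← ENNReal.ofReal_mul (by positivity),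
    ← ENNReal.ofReal_mul (by positivity), ← ENNReal.ofReal_mul (by positivity)]
  apply ENNReal.ofReal_le_ofReal
  have hsL : 0 < √L := Real.sqrt_pos.2 hL
  calc c * M⁻¹ * μ.real A * (1 - μ.real A) * √L
      = c * M⁻¹ * √L * (μ.real A * (1 - μ.real A)) := by ring
    _ ≤ c * M⁻¹ * √L * (√6 * (M * ∑ i, (I i).toReal) * (√(3 * Real.pi ^ 3 / L) / 2)) :=
        mul_le_mul_of_nonneg_left hle (by positivity)
    _ = ∑ i, (I i).toReal := by
        rw [Real.sqrt_div (by positivity), hc]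
        field_simp
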